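/- **Setting.** The Minkowski plane is $\mathbb R^2$ with metric $\eta=\mathrm{diag}(-1,1)$, volume form $\epsilon(v,w)=v^0w^1-v^1w^0$ and Hodge dual $*$ given by $\eta(*v,w)=\epsilon(v,w)$. A timelike/spacelike inelastic curve flow is a smooth map $\vec\gamma(t,x)$ on an open set of $\mathbb R^2$ with $\eta(\vec\gamma_x,\vec\gamma_x)=\mp1$. Put $T=\vec\gamma_x$, $N=*\vec\gamma_x$. The functions $u$ (curvature), $\omega$, $h_\parallel$, $h_\perp$ are the orthogonal components $u=\eta(T_x,N)/\eta(N,N)$, $\omega=\eta(T_t,N)/\eta(N,N)$, $h_\parallel=\eta(\vec\gamma_t,T)/\eta(T,T)$, $h_\perp=\eta(\vec\gamma_t,N)/\eta(N,N)$, that is, the coefficients in the frame equations $$T_x=uN,\quad N_x=uT,\quad T_t=\omega N,\quad N_t=\omega T,\quad \vec\gamma_t=h_\parallel T+h_\perp N .$$ A differential function is a smooth function of $x$ and finitely many of the jet coordinates $u_0=u,\ u_1=u_x,\ u_2=u_{xx},\dots$; $D_x$ is the total derivative. A functional $\int f\,dx$ is a differential function $f$ modulo total $x$-derivatives, with variational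 derivative $\delta/\delta u=\sum_k(-D_x)^k\partial_{u_k}$. For differential functions $X,f$, $f'[X]=\sum_k (D_x^kX)\,\partial f/\partial u_k$, and $[X,Y]=Y'[X]-X'[Y]$. $D_x^{-1}f$ denotes any $p$ of the class considered (functions smooth on the domain of the flow, or differential functions) with $D_xp=f$, so that operators containing $D_x^{-1}$ are linear relations; inverses, compositions and linear combinations of operators are those of linear relations. An operator $L$ is *Hamiltonian* if (i) $\int(\xi_1L\xi_2+\xi_2L\xi_1)\,dx=0$ for all $\xi_1,\xi_2$ in its domain; (ii) the bracket $\{\mathfrak F,\mathfrak G\}=\int(\delta\mathfrak F/\delta u)\,L(\delta\mathfrak G/\delta u)\,dx$ satisfies the Jacobi identity for all functionals with variational derivatives in the domain of $L$; (iii) the Jacobi identity holds for all covectors in the domain (not only variational derivatives): if $X_i=L\xi_i$, $i=1,2,3$, the cyclic sum of $\int(\xi_2'[X_1]X_3+\xi_2X_1'[X_3])\,dx$ vanishes. An operator is *symplectic* if its formal inverse is Hamiltonian. A Hamiltonian $\mathcal H$ and a symplectic $\mathcal J$ are *compatible* if, for all constants $c_1,c_2$, $c_1\mathcal H+c_2\mathcal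 J^{-1}$ is Hamiltonian and $c_1\mathcal H^{-1}+c_2\mathcal J$ is symplectic. An operator $\mathcal R$ is *hereditary* if $[\mathcal RX,\mathcal RY]=\mathcal R\big([\mathcal RX,Y]+[X,\mathcal RY]-\mathcal R[X,Y]\big)$ for all $X,Y$ in its domain, and a *recursion operator* of $u_t=K$ if $\mathcal R[K,X]=[K,\mathcal RX]$ for all $X$ in its domain. (For multivalued operators these two identities mean that they hold for every choice of the values of $\mathcal RX$ and $\mathcal RY$ and some choice of the remaining values.) **Theorem.** Let $$\mathcal H=D_x,\qquad \mathcal J=D_x-uD_x^{-1}u .$$ 1. For every timelike or spacelike inelastic curve flow in the Minkowski plane, the displayed frame equations hold, and $$u_t=\mathcal H(\omega),\qquad \omega=\mathcal J(h_\perp),\qquad u_t=\mathcal R(h_\perp),$$ where $D_x^{-1}(uh_\perp)=-h_\parallel$ and $\mathcal R=D_x^2-u^2-u_xD_x^{-1}u$. 2. On differential functions of $u$, $\mathcal H$ is a Hamiltonian operator, $\mathcal J$ is a symplectic operator, and they are compatible. 3. $\mathcal R=\mathcal H\mathcal J=D_x^2-u^2-u_xD_x^{-1}u$ is a hereditary recursion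 operator: it is hereditary, and it is a recursion operator of $u_t=u_x$ and of the defocusing mKdV equation $u_t=u_{xxx}-\tfrac32u^2u_x$, whose right-hand side is a value of $\mathcal R(u_x)$. -/

import Mathlib

open scoped ContDiff

namespace MinkowskiFlow

noncomputable section

/-! ### The Minkowski plane, in inertial coordinates `(X⁰, X¹)` -/

/-- The Minkowski metric `diag(-1, 1)`. -/
def eta (v w : ℝ × ℝ) : ℝ := -(v.1 * w.1) + v.2 * w.2

/-- The volume form. -/
def vol (v w : ℝ × ℝ) : ℝ := v.1 * w.2 - v.2 * w.1

/-- The Hodge dual `*v`; it is characterised by `eta_hodge`. -/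
def hodge (v : ℝ × ℝ) : ℝ × ℝ := (v.2, v.1)

theorem eta_hodge (v w : ℝ × ℝ) : eta (hodge v) w = vol v w := by
  simp only [eta, hodge, vol]; ring

/-! ### Curve flows `γ(t, x)`; a point of the parameter plane is `z = (t, x)` -/

/-- `∂/∂t`. -/
def dt {E : Type*} [NormedAddCommGroup E] [NormedSpace ℝ E] (f : ℝ × ℝ → E) (z : ℝ × ℝ) : E :=
  deriv (fun s => f (s, z.2)) z.1

/-- `∂/∂x`. -/
def dx {E : Type*} [NormedAddCommGroup E] [NormedSpace ℝ E] (f : ℝ × ℝ → E) (z : ℝ × ℝ) : E :=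
  deriv (fun s => f (z.1, s)) z.2

/-- A smooth inelastic flow of timelike (`σ = -1`) or spacelike (`σ = 1`) curves, defined for
`(t, x)` in an open region `U`: along the flow, `x` remains the proper-time or proper-distance
parameter, and the signature of the curve is preserved. -/
structure IsInelasticFlow (σ : ℝ) (U : Set (ℝ × ℝ)) (γ : ℝ × ℝ → ℝ × ℝ) : Prop where
  sign : σ = -1 ∨ σ = 1
  isOpen : IsOpen U
  smooth : ContDiffOn ℝ ∞ γ U
  arclength : ∀ z ∈ U, eta (dx γ z) (dx γ z) = σ

/-- The unit tangent vector `e_∥ = T = γ_x`. -/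
def tangent (γ : ℝ × ℝ → ℝ × ℝ) : ℝ × ℝ → ℝ × ℝ := dx γ

/-- The unit normal vector `e_⊥ = N = *γ_x`. -/
def normal (γ : ℝ × ℝ → ℝ × ℝ) (z : ℝ × ℝ) : ℝ × ℝ := hodge (dx γ z)

/-- The `e_∥`-component of a vector in the (orthogonal, non-null) Frenet frame. -/
def parComponent (γ v : ℝ × ℝ → ℝ × ℝ) (z : ℝ × ℝ) : ℝ :=
  eta (v z) (tangent γ z) / eta (tangent γ z) (tangent γ z)

/-- The `e_⊥`-component of a vector in the (orthogonal, non-null) Frenet frame. -/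
def perpComponent (γ v : ℝ × ℝ → ℝ × ℝ) (z : ℝ × ℝ) : ℝ :=
  eta (v z) (normal γ z) / eta (normal γ z) (normal γ z)

/-- The curvature invariant `u`, the `e_⊥`-component of `(e_∥)_x`. -/
def curvature (γ : ℝ × ℝ → ℝ × ℝ) : ℝ × ℝ → ℝ := perpComponent γ (dx (tangent γ))

/-- The invariant `ω` of the flow, the `e_⊥`-component of `(e_∥)_t`. -/
def omega (γ : ℝ × ℝ → ℝ × ℝ) : ℝ × ℝ → ℝ := perpComponent γ (dt (tangent γ))

/-- The tangential component `h_∥` of the flow vector `γ_t`. -/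
def hPar (γ : ℝ × ℝ → ℝ × ℝ) : ℝ × ℝ → ℝ := parComponent γ (dt γ)

/-- The normal component `h_⊥` of the flow vector `γ_t`. -/
def hPerp (γ : ℝ × ℝ → ℝ × ℝ) : ℝ × ℝ → ℝ := perpComponent γ (dt γ)

/-! ### The operators `H`, `J`, `R`

They are used both on functions of `(t, x)` and on differential functions of a jet variable `u`.
In both settings `D_x⁻¹ f` stands for any admissible `p` with `D_x p = f`, so that an operator
that contains `D_x⁻¹` is a linear relation: `L h w` says that `w` is a value of `L(h)`. -/

/-- The functions on `Z` that operators act on, the region where equations between them are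
read, and the derivative `D_x`. -/
structure Calculus (Z : Type) where
  region : Set Z
  functions : Set (Z → ℝ)
  D : (Z → ℝ) → (Z → ℝ)

/-- Possibly multivalued, possibly partially defined operators. -/
abbrev Op (Z : Type) : Type := (Z → ℝ) → (Z → ℝ) → Prop

section Operators

variable {Z : Type} (C : Calculus Z)

/-- `p` is a value of `D_x⁻¹ f`. -/
def IsPrimitive (p f : Z → ℝ) : Prop := p ∈ C.functions ∧ Set.EqOn (C.D p) f C.region

/-- `w = H(h)` with `H = D_x`. -/
def opH : Op Z := fun h w =>
  h ∈ C.functions ∧ w ∈ C.functions ∧ Set.EqOn w (C.D h) C.region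

/-- `w = D_x h - u p`, where `p` is a value of `D_x⁻¹(u h)`. -/
def JVia (u p : Z → ℝ) : Op Z := fun h w =>
  h ∈ C.functions ∧ w ∈ C.functions ∧ IsPrimitive C p (u * h) ∧
    Set.EqOn w (C.D h - u * p) C.region

/-- `w = J(h)` with `J = D_x - u D_x⁻¹ u`. On differential functions of `u` the domain contains
`h = 2 u_x g + u D_x g` for every `g`, since then `u h = D_x(u² g)`. -/
def opJ (u : Z → ℝ) : Op Z := fun h w => ∃ p, JVia C u p h w

/-- `w = D_x² h - u² h - u_x p`, where `p` is a value of `D_x⁻¹(u h)`. -/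
def RVia (u p : Z → ℝ) : Op Z := fun h w =>
  h ∈ C.functions ∧ w ∈ C.functions ∧ IsPrimitive C p (u * h) ∧
    Set.EqOn w (C.D (C.D h) - u ^ 2 * h - C.D u * p) C.region

/-- `w = R(h)` with `R = D_x² - u² - u_x D_x⁻¹ u`. -/
def opR (u : Z → ℝ) : Op Z := fun h w => ∃ p, RVia C u p h w

end Operators

/-- The composition `L₁ L₂`. -/
def Op.comp {Z : Type} (L₁ L₂ : Op Z) : Op Z := fun h w => ∃ v, L₂ h v ∧ L₁ v w

/-- The formal inverse `L⁻¹`. -/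
def Op.inv {Z : Type} (L : Op Z) : Op Z := fun w h => L h w

/-- The linear combination `c₁ L₁ + c₂ L₂`. -/
def Op.comb {Z : Type} (c₁ : ℝ) (L₁ : Op Z) (c₂ : ℝ) (L₂ : Op Z) : Op Z := fun h w =>
  ∃ w₁ w₂, L₁ h w₁ ∧ L₂ h w₂ ∧ w = c₁ • w₁ + c₂ • w₂

/-- The setting of functions of `(t, x)`, smooth on an open region `U`. -/
def flowCalculus (U : Set (ℝ × ℝ)) : Calculus (ℝ × ℝ) where
  region := U
  functions := {f | ContDiffOn ℝ ∞ f U}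
  D := dx

/-! ### The jet space `J^∞` of one variable `u(x)` -/

/-- A point `(x, (u, u_x, u_xx, …))` of the jet space. -/
abbrev Jet : Type := ℝ × (ℕ → ℝ)

/-- Differential functions: smooth functions of `x` and finitely many of the `u_k`. -/
def IsDiffFun (f : Jet → ℝ) : Prop :=
  ∃ (n : ℕ) (g : ℝ × (Fin n → ℝ) → ℝ), ContDiff ℝ ∞ g ∧ ∀ z : Jet, f z = g (z.1, fun i => z.2 i)

/-- The coordinate `u_k` (the `k`-th `x`-derivative of `u`). -/
def jetU (k : ℕ) : Jet → ℝ := fun z => z.2 k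

/-- `∂/∂x` at fixed `u_k`. -/
def partialX (f : Jet → ℝ) (z : Jet) : ℝ := deriv (fun s => f (s, z.2)) z.1

/-- `∂/∂u_k`. -/
def partialU (k : ℕ) (f : Jet → ℝ) (z : Jet) : ℝ :=
  deriv (fun s => f (z.1, Function.update z.2 k s)) (z.2 k)

/-- The total derivative `D_x = ∂/∂x + ∑ u_{k+1} ∂/∂u_k`. -/
def totalD (f : Jet → ℝ) (z : Jet) : ℝ :=
  partialX f z + ∑ᶠ k : ℕ, z.2 (k + 1) * partialU k f z

/-- `pr(X ∂_u) f = ∑ (D_x^k X) ∂f/∂u_k`, the derivative `f'[X]` of `f` along the evolutionary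
vector field `X ∂_u`. -/
def prol (X f : Jet → ℝ) (z : Jet) : ℝ := ∑ᶠ k : ℕ, (totalD^[k] X) z * partialU k f z

/-- The commutator of evolutionary vector fields, `[X, Y] = Y'[X] - X'[Y]`. -/
def bracket (X Y : Jet → ℝ) : Jet → ℝ := prol X Y - prol Y X

/-- The Euler operator: `δ𝔉/δu = ∑ (-D_x)^k (∂f/∂u_k)` for `𝔉 = ∫ f dx`. -/
def euler (f : Jet → ℝ) (z : Jet) : ℝ := ∑ᶠ k : ℕ, (-1) ^ k * (totalD^[k] (partialU k f)) z

/-- `∫ f dx = 0` as a functional on the jet space: `f` is a total `x`-derivative. -/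
def IntegralZero (f : Jet → ℝ) : Prop := ∃ g, IsDiffFun g ∧ totalD g = f

/-- The setting of differential functions. -/
def jetCalculus : Calculus Jet where
  region := Set.univ
  functions := {f | IsDiffFun f}
  D := totalD

/-- Hamiltonian operators. The bracket is `{𝔉, 𝔊} = ∫ (δ𝔉/δu) L(δ𝔊/δu) dx`. Since the domain of
an operator with nonlocal terms need not contain many variational derivatives, skew-symmetry and
the Jacobi identity are also required for all differential functions `ξ` in the domain: `schouten`
says that the Schouten bracket of `L` with itself vanishes, that is,
`∑_cyclic ∫ (ξ₂'[X₁] + (X₁')^* ξ₂) X₃ dx = 0` whenever `Xᵢ = L(ξᵢ)`; here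
`∫ ((X₁')^* ξ₂) X₃ dx = ∫ ξ₂ X₁'[X₃] dx`. -/
structure IsHamiltonian (L : Op Jet) : Prop where
  skew : ∀ ξ₁ ξ₂ X₁ X₂, L ξ₁ X₁ → L ξ₂ X₂ → IntegralZero (ξ₁ * X₂ + ξ₂ * X₁)
  jacobi : ∀ f₁ f₂ f₃ X₁ X₂ X₃, IsDiffFun f₁ → IsDiffFun f₂ → IsDiffFun f₃ →
    L (euler f₁) X₁ → L (euler f₂) X₂ → L (euler f₃) X₃ →
    IntegralZero (euler (euler f₁ * X₂) * X₃ + euler (euler f₂ * X₃) * X₁ +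
      euler (euler f₃ * X₁) * X₂)
  schouten : ∀ ξ₁ ξ₂ ξ₃ X₁ X₂ X₃, L ξ₁ X₁ → L ξ₂ X₂ → L ξ₃ X₃ →
    IntegralZero ((prol X₁ ξ₂ * X₃ + ξ₂ * prol X₃ X₁) + (prol X₂ ξ₃ * X₁ + ξ₃ * prol X₁ X₂) +
      (prol X₃ ξ₁ * X₂ + ξ₁ * prol X₂ X₃))

/-- Symplectic operators: the formal inverse is Hamiltonian. (For `Xᵢ ↦ ξᵢ = S(Xᵢ)`, the condition
`schouten` on the inverse is closedness of the two-form `∫ Y S(X) dx`.) -/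
def IsSymplectic (S : Op Jet) : Prop := IsHamiltonian S.inv

/-- Compatibility of a Hamiltonian operator `H` and a symplectic operator `J`: all
`c₁ H + c₂ J⁻¹` are Hamiltonian and all `c₁ H⁻¹ + c₂ J` are symplectic. -/
def IsCompatiblePair (H J : Op Jet) : Prop :=
  ∀ c₁ c₂ : ℝ, IsHamiltonian (Op.comb c₁ H c₂ J.inv) ∧ IsSymplectic (Op.comb c₁ H.inv c₂ J)

/-- Hereditary operators: the Nijenhuis torsion vanishes,
`[R X, R Y] = R([R X, Y] + [X, R Y] - R[X, Y])`, for all `X`, `Y` in the domain. -/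
def IsHereditary (R : Op Jet) : Prop :=
  ∀ X Y X' Y', R X X' → R Y Y' →
    ∃ W, R (bracket X Y) W ∧ R (bracket X' Y + bracket X Y' - W) (bracket X' Y')

/-- `R` is a recursion operator of the evolution equation `u_t = K`: its Lie derivative along
`K ∂_u` vanishes, `R [K, X] = [K, R X]`. -/
def IsRecursionOperatorOf (R : Op Jet) (K : Jet → ℝ) : Prop :=
  ∀ X X', R X X' → R (bracket K X) (bracket K X')

end

end MinkowskiFlow

namespace MinkowskiFlow

noncomputable section

/-! ### The algebra of differential functions and its derivations -/

/-! For curve flows, differentiating the constant `η(T,T)` removes the tangential parts of `T_x` and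
`T_t`, and the Hodge dual gives `N_x` and `N_t`. The three operator equations are then the
components of `T_xt = T_tx` and `γ_xt = γ_tx` in the frame `T, N`.

For the operators, differential functions form a commutative algebra on which `D_x` and every
evolutionary field `ev_X` act as derivations. Two facts are needed: `ev_X` commutes with `D_x`
(`evol_totalDer`), and `[ev_X, ev_Y]` is the evolutionary field of `[X, Y]` (`commutator_evol`).
Each value of `D_x⁻¹(u h)` is replaced by an element `p` with `D_x p = u h`, so all the conditions
become identities in a commutative ring with commuting derivations, and `∫ f = 0` is proved by
writing down a primitive of `f`.

The Jacobi identity for functionals follows from the Schouten identity, because the Fréchet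
derivative of a variational derivative is self-adjoint (`evol_euler_symm`). The Schouten identity
for `J` has a simple source: with `p = D_x⁻¹(u Y)`, its two-form is `∫ (Y₁ D_x Y₂ + p₁ D_x p₂)`, and
`p` is formally the variation of `D_x⁻¹(u²/2)`, so the form is the pullback of one with constant
coefficients and is closed. Compatibility adds one explicit mixed primitive
(`schouten_comb_opH_inv_opJ`). Heredity and the recursion property come from explicit primitives for
the nonlocal terms on both sides. -/

/-- The truncation of a jet to `x` and the first `n` jet coordinates. -/
def jetTrunc (n : ℕ) (z : Jet) : ℝ × (Fin n → ℝ) := (z.1, fun i => z.2 i)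

/-- The direction `∂/∂u_k` in the truncated jet space (zero for `k ≥ n`). -/
def jetDir (n k : ℕ) : ℝ × (Fin n → ℝ) := (0, fun j => if (j : ℕ) = k then 1 else 0)

theorem jetDir_of_le {n k : ℕ} (h : n ≤ k) : jetDir n k = 0 := by
  unfold jetDir
  refine Prod.ext rfl (funext fun j => ?_)
  have := j.2
  simp only [Prod.snd_zero, Pi.zero_apply, ite_eq_right_iff]
  omega

theorem isDiffFun_comp_jetTrunc {n : ℕ} {g : ℝ × (Fin n → ℝ) → ℝ} (hg : ContDiff ℝ ∞ g) :
    IsDiffFun (g ∘ jetTrunc n) := ⟨n, g, hg, fun _ => rfl⟩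

theorem IsDiffFun.exists_eq_comp {f : Jet → ℝ} (hf : IsDiffFun f) :
    ∃ (n : ℕ) (g : ℝ × (Fin n → ℝ) → ℝ), ContDiff ℝ ∞ g ∧ f = g ∘ jetTrunc n := by
  obtain ⟨n, g, hg, h⟩ := hf
  exact ⟨n, g, hg, funext h⟩

theorem IsDiffFun.exists_eq_comp_of_le {f : Jet → ℝ} (hf : IsDiffFun f) :
    ∃ n : ℕ, ∀ m, n ≤ m →
      ∃ g : ℝ × (Fin m → ℝ) → ℝ, ContDiff ℝ ∞ g ∧ f = g ∘ jetTrunc m := by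
  obtain ⟨n, g, hg, rfl⟩ := hf.exists_eq_comp
  refine ⟨n, fun m hm => ⟨fun y => g (y.1, fun i => y.2 (Fin.castLE hm i)), ?_, rfl⟩⟩
  exact hg.comp (by fun_prop)

/-- Placing two differential functions on one truncated jet space reduces sums, products and Leibniz
rules to finite-dimensional calculus. -/
theorem IsDiffFun.exists_common {f₁ f₂ : Jet → ℝ} (h₁ : IsDiffFun f₁) (h₂ : IsDiffFun f₂) :
    ∃ (n : ℕ) (g₁ g₂ : ℝ × (Fin n → ℝ) → ℝ), ContDiff ℝ ∞ g₁ ∧ ContDiff ℝ ∞ g₂ ∧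
      f₁ = g₁ ∘ jetTrunc n ∧ f₂ = g₂ ∘ jetTrunc n := by
  obtain ⟨n₁, H₁⟩ := h₁.exists_eq_comp_of_le
  obtain ⟨n₂, H₂⟩ := h₂.exists_eq_comp_of_le
  obtain ⟨g₁, hg₁, e₁⟩ := H₁ (max n₁ n₂) (le_max_left _ _)
  obtain ⟨g₂, hg₂, e₂⟩ := H₂ (max n₁ n₂) (le_max_right _ _)
  exact ⟨_, g₁, g₂, hg₁, hg₂, e₁, e₂⟩

theorem partialX_comp_jetTrunc {n : ℕ} {g : ℝ × (Fin n → ℝ) → ℝ} (hg : ContDiff ℝ ∞ g) :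
    partialX (g ∘ jetTrunc n) = (fun y => fderiv ℝ g y (1, 0)) ∘ jetTrunc n := by
  funext z
  have hc : HasDerivAt (fun s : ℝ => jetTrunc n (s, z.2)) (1, 0) z.1 :=
    (hasDerivAt_id z.1).prodMk (hasDerivAt_const z.1 fun i : Fin n => z.2 i)
  have hd : HasFDerivAt g (fderiv ℝ g (jetTrunc n z)) (jetTrunc n (z.1, z.2)) :=
    (hg.differentiable (by simp) _).hasFDerivAt
  exact (hd.comp_hasDerivAt z.1 hc).deriv

theorem partialU_comp_jetTrunc {n : ℕ} {g : ℝ × (Fin n → ℝ) → ℝ} (hg : ContDiff ℝ ∞ g) (k : ℕ) :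
    partialU k (g ∘ jetTrunc n) = (fun y => fderiv ℝ g y (jetDir n k)) ∘ jetTrunc n := by
  funext z
  have hc : HasDerivAt (fun s : ℝ => jetTrunc n (z.1, Function.update z.2 k s)) (jetDir n k)
      (z.2 k) := by
    refine (hasDerivAt_const _ _).prodMk (hasDerivAt_pi.2 fun j => ?_)
    by_cases h : (j : ℕ) = k
    · simpa [h] using hasDerivAt_id' (z.2 k)
    · simpa [h] using hasDerivAt_const (z.2 k) (z.2 j)
  have hd : HasFDerivAt g (fderiv ℝ g (jetTrunc n z))
      (jetTrunc n (z.1, Function.update z.2 k (z.2 k))) := by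
    rw [Function.update_eq_self]
    exact (hg.differentiable (by simp) _).hasFDerivAt
  exact (hd.comp_hasDerivAt (z.2 k) hc).deriv

theorem contDiff_fderiv_apply_const {E : Type*} [NormedAddCommGroup E] [NormedSpace ℝ E] {g : E → ℝ}
    (hg : ContDiff ℝ ∞ g) (v : E) : ContDiff ℝ ∞ fun y => fderiv ℝ g y v :=
  (hg.fderiv_right (m := ∞) (by simp)).clm_apply contDiff_const

theorem fderiv_fderiv_apply_comm {E : Type*} [NormedAddCommGroup E] [NormedSpace ℝ E] {g : E → ℝ}
    (hg : ContDiff ℝ ∞ g) (v w y : E) :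
    fderiv ℝ (fun y => fderiv ℝ g y v) y w = fderiv ℝ (fun y => fderiv ℝ g y w) y v := by
  have hd : DifferentiableAt ℝ (fderiv ℝ g) y :=
    (hg.fderiv_right (m := ∞) (by simp)).differentiable (by simp) y
  have key : ∀ v w : E, fderiv ℝ (fun y => fderiv ℝ g y v) y w = fderiv ℝ (fderiv ℝ g) y w v := by
    intro v w
    rw [fderiv_clm_apply hd (differentiableAt_const v)]
    simp
  rw [key, key]
  exact ((contDiff_infty.1 hg 2).contDiffAt.isSymmSndFDerivAt (by simp)) w v

/-- The algebra of differential functions. -/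
def diffAlg : Subalgebra ℝ (Jet → ℝ) where
  carrier := {f | IsDiffFun f}
  mul_mem' := by
    intro a b ha hb
    obtain ⟨n, g₁, g₂, h₁, h₂, rfl, rfl⟩ := IsDiffFun.exists_common ha hb
    exact isDiffFun_comp_jetTrunc (h₁.mul h₂)
  add_mem' := by
    intro a b ha hb
    obtain ⟨n, g₁, g₂, h₁, h₂, rfl, rfl⟩ := IsDiffFun.exists_common ha hb
    exact isDiffFun_comp_jetTrunc (h₁.add h₂)
  algebraMap_mem' := fun r =>
    isDiffFun_comp_jetTrunc (n := 0) (g := fun _ => r) contDiff_const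

/-- The derivation of the algebra of differential functions given by an operator that acts on the
functions of each truncated jet space as a directional derivative. -/
def derOfDir (P : (Jet → ℝ) → Jet → ℝ) (v : ∀ n : ℕ, ℝ × (Fin n → ℝ))
    (hP : ∀ (n : ℕ) (g : ℝ × (Fin n → ℝ) → ℝ), ContDiff ℝ ∞ g →
      P (g ∘ jetTrunc n) = (fun y => fderiv ℝ g y (v n)) ∘ jetTrunc n) :
    Derivation ℝ diffAlg diffAlg :=
  Derivation.mk'
    { toFun := fun f => ⟨P f, by
        obtain ⟨n, g, hg, e⟩ := IsDiffFun.exists_eq_comp f.2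
        rw [e, hP n g hg]
        exact isDiffFun_comp_jetTrunc (contDiff_fderiv_apply_const hg _)⟩
      map_add' := by
        rintro ⟨f₁, hf₁⟩ ⟨f₂, hf₂⟩
        obtain ⟨n, g₁, g₂, h₁, h₂, rfl, rfl⟩ := IsDiffFun.exists_common hf₁ hf₂
        refine Subtype.ext ?_
        change P ((g₁ + g₂) ∘ jetTrunc n) = P (g₁ ∘ jetTrunc n) + P (g₂ ∘ jetTrunc n)
        rw [hP n (g₁ + g₂) (h₁.add h₂), hP n _ h₁, hP n _ h₂]
        funext z
        simp [fderiv_add (h₁.differentiable (by simp) _) (h₂.differentiable (by simp) _)]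
      map_smul' := by
        rintro c ⟨f, hf⟩
        obtain ⟨n, g, h, rfl⟩ := IsDiffFun.exists_eq_comp hf
        refine Subtype.ext ?_
        change P ((c • g) ∘ jetTrunc n) = c • P (g ∘ jetTrunc n)
        rw [hP n (c • g) (contDiff_const.smul h), hP n _ h]
        funext z
        simp [fderiv_const_smul (h.differentiable (by simp) _)] }
    (by
      rintro ⟨f₁, hf₁⟩ ⟨f₂, hf₂⟩
      obtain ⟨n, g₁, g₂, h₁, h₂, rfl, rfl⟩ := IsDiffFun.exists_common hf₁ hf₂
      refine Subtype.ext ?_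
      change P ((g₁ * g₂) ∘ jetTrunc n) =
        (g₁ ∘ jetTrunc n) * P (g₂ ∘ jetTrunc n) + (g₂ ∘ jetTrunc n) * P (g₁ ∘ jetTrunc n)
      rw [hP n (g₁ * g₂) (h₁.mul h₂), hP n _ h₁, hP n _ h₂]
      funext z
      simp [fderiv_mul (h₁.differentiable (by simp) _) (h₂.differentiable (by simp) _)])

/-- The derivation `∂/∂x` of the algebra of differential functions. -/
def derX : Derivation ℝ diffAlg diffAlg :=
  derOfDir partialX (fun _ => (1, 0)) fun _ _ hg => partialX_comp_jetTrunc hg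

/-- The derivation `∂/∂u_k` of the algebra of differential functions. -/
def derU (k : ℕ) : Derivation ℝ diffAlg diffAlg :=
  derOfDir (partialU k) (jetDir · k) fun _ _ hg => partialU_comp_jetTrunc hg k

@[simp] theorem coe_derX (f : diffAlg) : (derX f : Jet → ℝ) = partialX f := rfl

@[simp] theorem coe_derU (k : ℕ) (f : diffAlg) : (derU k f : Jet → ℝ) = partialU k f := rfl

theorem derX_derU_comm (k : ℕ) (f : diffAlg) : derX (derU k f) = derU k (derX f) := by
  obtain ⟨f, hf⟩ := f
  obtain ⟨n, g, h, rfl⟩ := IsDiffFun.exists_eq_comp hf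
  refine Subtype.ext ?_
  simp only [coe_derX, coe_derU]
  rw [partialX_comp_jetTrunc h, partialU_comp_jetTrunc h,
    partialX_comp_jetTrunc (contDiff_fderiv_apply_const h _),
    partialU_comp_jetTrunc (contDiff_fderiv_apply_const h _)]
  funext z
  exact fderiv_fderiv_apply_comm h _ _ _

theorem derU_derU_comm (j k : ℕ) (f : diffAlg) : derU j (derU k f) = derU k (derU j f) := by
  obtain ⟨f, hf⟩ := f
  obtain ⟨n, g, h, rfl⟩ := IsDiffFun.exists_eq_comp hf
  refine Subtype.ext ?_
  simp only [coe_derU]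
  rw [partialU_comp_jetTrunc h, partialU_comp_jetTrunc h,
    partialU_comp_jetTrunc (contDiff_fderiv_apply_const h _),
    partialU_comp_jetTrunc (contDiff_fderiv_apply_const h _)]
  funext z
  exact fderiv_fderiv_apply_comm h _ _ _

theorem exists_derU_eq_zero (f : diffAlg) : ∃ n, ∀ k, n ≤ k → derU k f = 0 := by
  obtain ⟨f, hf⟩ := f
  obtain ⟨n, g, h, rfl⟩ := IsDiffFun.exists_eq_comp hf
  refine ⟨n, fun k hk => Subtype.ext ?_⟩
  simp only [coe_derU]
  rw [partialU_comp_jetTrunc h, jetDir_of_le hk]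
  funext z
  simp

theorem support_mul_derU_finite (V : ℕ → diffAlg) (f : diffAlg) :
    (Function.support fun k => V k * derU k f).Finite := by
  obtain ⟨n, hn⟩ := exists_derU_eq_zero f
  refine (Set.finite_lt_nat n).subset fun k hk => ?_
  by_contra h
  exact hk (by simp [hn k (not_lt.1 h)])

/-! ### Vector fields on the jet space and their commutators. -/

/-- The derivation `a ∂/∂x + ∑ V_k ∂/∂u_k`. -/
def jetVectorField (a : ℝ) (V : ℕ → diffAlg) : Derivation ℝ diffAlg diffAlg :=
  Derivation.mk'
    { toFun := fun f => a • derX f + ∑ᶠ k, V k * derU k f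
      map_add' := fun f g => by
        simp only [map_add, mul_add]
        rw [finsum_add_distrib (support_mul_derU_finite V f) (support_mul_derU_finite V g),
          smul_add]
        abel
      map_smul' := fun c f => by
        simp only [Derivation.map_smul, mul_smul_comm, RingHom.id_apply, smul_add]
        rw [← smul_finsum, smul_comm] }
    (fun f g => by
      have e : ∀ (k : ℕ), V k * derU k (f * g) = f * (V k * derU k g) + g * (V k * derU k f) := by
        intro k
        rw [Derivation.leibniz, smul_eq_mul, smul_eq_mul]
        ring
      have hf : ∀ f g : diffAlg, (Function.support fun k => f * (V k * derU k g)).Finite :=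
        fun f g => (support_mul_derU_finite V g).subset fun k hk h => hk ((congrArg (f * ·) h).trans (mul_zero f))
      simp only [LinearMap.coe_mk, AddHom.coe_mk, e]
      rw [finsum_add_distrib (hf _ _) (hf _ _), ← mul_finsum' _ _ (support_mul_derU_finite V g),
        ← mul_finsum' _ _ (support_mul_derU_finite V f), Derivation.leibniz]
      simp only [smul_eq_mul, smul_add, mul_add, mul_smul_comm]
      abel)

theorem jetVectorField_apply (a : ℝ) (V : ℕ → diffAlg) (f : diffAlg) {n : ℕ}
    (hn : ∀ k, n ≤ k → derU k f = 0) :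
    jetVectorField a V f = a • derX f + ∑ k ∈ Finset.range n, V k * derU k f := by
  change a • derX f + ∑ᶠ k, V k * derU k f = _
  congr 1
  refine finsum_eq_sum_of_support_subset _ fun k hk => ?_
  by_contra h
  exact hk (by simp [hn k (by simpa using h)])

theorem coe_jetVectorField (a : ℝ) (V : ℕ → diffAlg) (f : diffAlg) (z : Jet) :
    (jetVectorField a V f : Jet → ℝ) z =
      a * partialX f z + ∑ᶠ k, (V k : Jet → ℝ) z * partialU k f z := by
  obtain ⟨n, hn⟩ := exists_derU_eq_zero f
  rw [jetVectorField_apply a V f hn, finsum_eq_sum_of_support_subset (s := Finset.range n)]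
  · simp
  · intro k hk
    by_contra h
    refine hk ?_
    have := congrFun (congrArg Subtype.val (hn k (by simpa using h))) z
    simp only [coe_derU] at this
    simp [this]

/-- The second-order terms cancel because the partial derivatives commute. Since `a` and `b` are
constants, no `∂/∂x` term survives, and only the derivatives of the coefficients of `∂/∂u_k` remain.
-/
theorem commutator_jetVectorField (a b : ℝ) (V W : ℕ → diffAlg) (f : diffAlg) :
    jetVectorField a V (jetVectorField b W f) - jetVectorField b W (jetVectorField a V f) =
      jetVectorField 0 (fun k => jetVectorField a V (W k) - jetVectorField b W (V k)) f := by
  obtain ⟨n, hn⟩ := exists_derU_eq_zero f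
  have hX : ∀ k, n ≤ k → derU k (derX f) = 0 := fun k hk => by
    rw [← derX_derU_comm, hn k hk, map_zero]
  have hU : ∀ j k, n ≤ k → derU k (derU j f) = 0 := fun j k hk => by
    rw [derU_derU_comm, hn k hk, map_zero]
  -- The first sum is the part that survives; up to commuting partial derivatives, the bracket is
  -- unchanged when `(a, V)` and `(b, W)` are exchanged.
  have key : ∀ (a b : ℝ) (V W : ℕ → diffAlg), jetVectorField a V (jetVectorField b W f) =
      ∑ k ∈ Finset.range n, jetVectorField a V (W k) * derU k f +
      (b • a • derX (derX f) + b • ∑ k ∈ Finset.range n, V k * derX (derU k f) +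
        a • ∑ k ∈ Finset.range n, W k * derX (derU k f) +
        ∑ k ∈ Finset.range n, ∑ j ∈ Finset.range n, W k * (V j * derU j (derU k f))) := by
    intro a b V W
    rw [jetVectorField_apply b W f hn, map_add, Derivation.map_smul, map_sum,
      jetVectorField_apply a V (derX f) hX]
    simp only [Derivation.leibniz, jetVectorField_apply a V (derU _ f) (hU _), smul_eq_mul,
      mul_add, Finset.sum_add_distrib, Finset.mul_sum, Finset.smul_sum, smul_add, derX_derU_comm,
      mul_smul_comm]
    simp only [mul_comm (derU _ f)]
    abel
  rw [key, key, jetVectorField_apply _ _ f hn, zero_smul, zero_add]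
  have hsym : ∑ k ∈ Finset.range n, ∑ j ∈ Finset.range n, W k * (V j * derU j (derU k f)) =
      ∑ k ∈ Finset.range n, ∑ j ∈ Finset.range n, V k * (W j * derU j (derU k f)) := by
    rw [Finset.sum_comm]
    refine Finset.sum_congr rfl fun j _ => Finset.sum_congr rfl fun k _ => ?_
    rw [derU_derU_comm]
    ring
  rw [hsym, smul_comm a b]
  simp only [sub_mul, Finset.sum_sub_distrib]
  abel

/-- The jet coordinate `u_k` as an element of the algebra of differential functions. -/
def jetCoord (k : ℕ) : diffAlg :=
  ⟨jetU k, isDiffFun_comp_jetTrunc (n := k + 1) (g := fun y => y.2 (Fin.last k)) (by fun_prop)⟩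

@[simp] theorem coe_jetCoord (k : ℕ) : (jetCoord k : Jet → ℝ) = jetU k := rfl

theorem derX_jetCoord (k : ℕ) : derX (jetCoord k) = 0 := by
  refine Subtype.ext (funext fun z => ?_)
  simp [partialX, jetU]

theorem derU_jetCoord (j k : ℕ) : derU j (jetCoord k) = if j = k then 1 else 0 := by
  refine Subtype.ext (funext fun z => ?_)
  by_cases h : j = k
  · subst h
    simp [partialU, jetU]
  · simp [partialU, jetU, h, Function.update_of_ne (Ne.symm h)]

theorem jetVectorField_jetCoord (a : ℝ) (V : ℕ → diffAlg) (k : ℕ) :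
    jetVectorField a V (jetCoord k) = V k := by
  rw [jetVectorField_apply (n := k + 1) a V, derX_jetCoord]
  · simp [derU_jetCoord]
  · intro j hj
    rw [derU_jetCoord, if_neg (by omega)]

/-! ### The total derivative and evolutionary vector fields. -/

/-- The total derivative as a derivation. -/
def totalDer : Derivation ℝ diffAlg diffAlg := jetVectorField 1 fun k => jetCoord (k + 1)

@[simp] theorem coe_totalDer (f : diffAlg) : (totalDer f : Jet → ℝ) = totalD f := by
  funext z
  rw [totalDer, coe_jetVectorField]
  simp [totalD, jetU]

theorem coe_iterate_totalDer (k : ℕ) (f : diffAlg) :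
    ((totalDer^[k] f : diffAlg) : Jet → ℝ) = totalD^[k] f := by
  induction k with
  | zero => rfl
  | succ k ih => rw [Function.iterate_succ_apply', Function.iterate_succ_apply', coe_totalDer, ih]

/-- The prolonged evolutionary vector field `pr(X ∂_u)` as a derivation. -/
def evol (X : diffAlg) : Derivation ℝ diffAlg diffAlg := jetVectorField 0 fun k => totalDer^[k] X

@[simp] theorem coe_evol (X f : diffAlg) : (evol X f : Jet → ℝ) = prol X f := by
  funext z
  rw [evol, coe_jetVectorField]
  simp [prol, coe_iterate_totalDer]

@[simp] theorem totalDer_jetCoord (k : ℕ) : totalDer (jetCoord k) = jetCoord (k + 1) :=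
  jetVectorField_jetCoord _ _ _

@[simp] theorem evol_jetCoord_zero (X : diffAlg) : evol X (jetCoord 0) = X :=
  jetVectorField_jetCoord _ _ _

theorem evol_jetCoord (X : diffAlg) (k : ℕ) : evol X (jetCoord k) = totalDer^[k] X :=
  jetVectorField_jetCoord _ _ _

/-- The commutator of the two fields has coefficients `ev_X(u_{k+1}) - D_x(D_x^k X)`, and these
vanish: this is what prolongation is designed for. -/
theorem evol_totalDer (X f : diffAlg) : evol X (totalDer f) = totalDer (evol X f) := by
  have h := commutator_jetVectorField 0 1 (fun k => totalDer^[k] X) (fun k => jetCoord (k + 1)) f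
  have h0 : (fun k => jetVectorField 0 (fun k => totalDer^[k] X) (jetCoord (k + 1)) -
      jetVectorField 1 (fun k => jetCoord (k + 1)) (totalDer^[k] X)) = fun _ => (0 : diffAlg) := by
    funext k
    rw [jetVectorField_jetCoord, Function.iterate_succ_apply']
    exact sub_self _
  obtain ⟨n, hn⟩ := exists_derU_eq_zero f
  rw [h0, jetVectorField_apply 0 (fun _ => 0) f hn] at h
  simp only [zero_smul, zero_mul, Finset.sum_const_zero, add_zero] at h
  exact sub_eq_zero.1 h

theorem evol_iterate_totalDer (X f : diffAlg) (k : ℕ) :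
    evol X (totalDer^[k] f) = totalDer^[k] (evol X f) := by
  induction k with
  | zero => rfl
  | succ k ih => rw [Function.iterate_succ_apply', Function.iterate_succ_apply', evol_totalDer, ih]

theorem iterate_totalDer_sub (X Y : diffAlg) (k : ℕ) :
    totalDer^[k] (X - Y) = totalDer^[k] X - totalDer^[k] Y := by
  induction k with
  | zero => rfl
  | succ k ih => simp only [Function.iterate_succ_apply', ih, map_sub]

theorem commutator_evol (X Y f : diffAlg) :
    evol X (evol Y f) - evol Y (evol X f) = evol (evol X Y - evol Y X) f := by
  refine (commutator_jetVectorField _ _ _ _ f).trans ?_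
  rw [evol]
  congr 2
  funext k
  rw [iterate_totalDer_sub, ← evol_iterate_totalDer, ← evol_iterate_totalDer]
  rfl

theorem coe_bracket (X Y : diffAlg) :
    bracket (X : Jet → ℝ) Y = ((evol X Y - evol Y X : diffAlg) : Jet → ℝ) := by
  simp [bracket]

theorem integralZero_coe_iff (f : diffAlg) :
    IntegralZero (f : Jet → ℝ) ↔ ∃ g : diffAlg, totalDer g = f := by
  constructor
  · rintro ⟨g, hg, h⟩
    exact ⟨⟨g, hg⟩, Subtype.ext (by simpa using h)⟩
  · rintro ⟨g, rfl⟩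
    exact ⟨g, g.2, (coe_totalDer g).symm⟩

/-! ### Functionals and variational derivatives -/

/-- The total derivatives of differential functions. -/
def exactForms : Submodule ℝ diffAlg := LinearMap.range (totalDer : diffAlg →ₗ[ℝ] diffAlg)

theorem totalDer_mem_exactForms (f : diffAlg) : totalDer f ∈ exactForms := ⟨f, rfl⟩

theorem integralZero_of_mem_exactForms {f : diffAlg} (h : f ∈ exactForms) :
    IntegralZero (f : Jet → ℝ) := (integralZero_coe_iff f).2 h

/-- Integration by parts `k` times. The induction moves one derivative onto `a`, with error `D_x(a
D_x^k b)`, which is why `a` is generalized. -/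
theorem iterate_totalDer_mul_sub_mem_exactForms (k : ℕ) (a b : diffAlg) :
    (-1) ^ k * totalDer^[k] a * b - a * totalDer^[k] b ∈ exactForms := by
  induction k generalizing a with
  | zero => simp
  | succ k ih =>
    have h := exactForms.neg_mem (exactForms.add_mem (ih (totalDer a))
      (totalDer_mem_exactForms (a * totalDer^[k] b)))
    convert h using 1
    rw [Derivation.leibniz, ← Function.iterate_succ_apply, Function.iterate_succ_apply' _ k b,
      smul_eq_mul, smul_eq_mul]
    ring

/-- The first variation formula `∫ (δf/δu) Y = ∫ f'[Y]`, obtained by integrating each term `(D_x^k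
Y) ∂f/∂u_k` by parts. -/
theorem exists_coe_eq_euler (f : diffAlg) : ∃ e : diffAlg, (e : Jet → ℝ) = euler f ∧
    ∀ Y, e * Y - evol Y f ∈ exactForms := by
  obtain ⟨n, hn⟩ := exists_derU_eq_zero f
  refine ⟨∑ k ∈ Finset.range n, (-1) ^ k * totalDer^[k] (derU k f), ?_, fun Y => ?_⟩
  · funext z
    unfold euler
    rw [finsum_eq_sum_of_support_subset (s := Finset.range n)]
    · simp [coe_iterate_totalDer]
    · intro k hk
      by_contra h
      refine hk ?_
      have h0 := hn k (by simpa using h)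
      have hz : totalDer^[k] (derU k f) = 0 := by
        rw [h0]
        exact Function.iterate_fixed (map_zero totalDer) k
      have := congrFun (congrArg Subtype.val hz) z
      simp only [coe_iterate_totalDer, coe_derU] at this
      simp [this]
  · rw [evol, jetVectorField_apply 0 _ f hn, zero_smul, zero_add, Finset.sum_mul,
      ← Finset.sum_sub_distrib]
    refine Submodule.sum_mem _ fun k _ => ?_
    rw [mul_comm (totalDer^[k] Y)]
    exact iterate_totalDer_mul_sub_mem_exactForms k _ _

theorem evol_mem_exactForms (X : diffAlg) {f : diffAlg} (hf : f ∈ exactForms) :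
    evol X f ∈ exactForms := by
  obtain ⟨g, rfl⟩ := hf
  exact ⟨evol X g, (evol_totalDer X g).symm⟩

/-- Variational derivatives have self-adjoint Fréchet derivatives. -/
theorem evol_euler_symm {f e : diffAlg} (he : ∀ Y, e * Y - evol Y f ∈ exactForms) (X Y : diffAlg) :
    evol X e * Y - evol Y e * X ∈ exactForms := by
  -- Differentiate the first variation formula for `Y` along `X`, antisymmetrize, and subtract the
  -- formula for `[X, Y]`: the second variations of `f` cancel by `commutator_evol`.
  have h := exactForms.sub_mem (exactForms.sub_mem (evol_mem_exactForms X (he Y))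
    (evol_mem_exactForms Y (he X))) (he (evol X Y - evol Y X))
  convert h using 1
  rw [← commutator_evol]
  simp only [map_sub, Derivation.leibniz, smul_eq_mul]
  ring

/-- For operators on differential functions, the Jacobi identity for functionals follows from the
vanishing of the Schouten bracket. -/
theorem isHamiltonian_of_exactForms {L : Op Jet}
    (hL : ∀ ξ X, L ξ X → IsDiffFun ξ ∧ IsDiffFun X)
    (skew : ∀ ξ₁ ξ₂ X₁ X₂ : diffAlg, L ξ₁ X₁ → L ξ₂ X₂ → ξ₁ * X₂ + ξ₂ * X₁ ∈ exactForms)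
    (schouten : ∀ ξ₁ ξ₂ ξ₃ X₁ X₂ X₃ : diffAlg, L ξ₁ X₁ → L ξ₂ X₂ → L ξ₃ X₃ →
      (evol X₁ ξ₂ * X₃ + ξ₂ * evol X₃ X₁) + (evol X₂ ξ₃ * X₁ + ξ₃ * evol X₁ X₂) +
        (evol X₃ ξ₁ * X₂ + ξ₁ * evol X₂ X₃) ∈ exactForms) :
    IsHamiltonian L where
  skew ξ₁ ξ₂ X₁ X₂ h₁ h₂ := by
    lift ξ₁ to diffAlg using (hL _ _ h₁).1
    lift X₁ to diffAlg using (hL _ _ h₁).2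
    lift ξ₂ to diffAlg using (hL _ _ h₂).1
    lift X₂ to diffAlg using (hL _ _ h₂).2
    exact integralZero_of_mem_exactForms (skew _ _ _ _ h₁ h₂)
  jacobi f₁ f₂ f₃ X₁ X₂ X₃ hf₁ hf₂ hf₃ h₁ h₂ h₃ := by
    lift X₁ to diffAlg using (hL _ _ h₁).2
    lift X₂ to diffAlg using (hL _ _ h₂).2
    lift X₃ to diffAlg using (hL _ _ h₃).2
    obtain ⟨ξ₁, c₁, he₁⟩ := exists_coe_eq_euler ⟨f₁, hf₁⟩
    obtain ⟨ξ₂, c₂, he₂⟩ := exists_coe_eq_euler ⟨f₂, hf₂⟩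
    obtain ⟨ξ₃, c₃, he₃⟩ := exists_coe_eq_euler ⟨f₃, hf₃⟩
    simp only at c₁ c₂ c₃
    rw [← c₁] at h₁ ⊢
    rw [← c₂] at h₂ ⊢
    rw [← c₃] at h₃ ⊢
    obtain ⟨E₁, d₁, hE₁⟩ := exists_coe_eq_euler (ξ₁ * X₂)
    obtain ⟨E₂, d₂, hE₂⟩ := exists_coe_eq_euler (ξ₂ * X₃)
    obtain ⟨E₃, d₃, hE₃⟩ := exists_coe_eq_euler (ξ₃ * X₁)
    rw [MulMemClass.coe_mul] at d₁ d₂ d₃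
    rw [← d₁, ← d₂, ← d₃]
    refine integralZero_of_mem_exactForms (f := E₁ * X₃ + E₂ * X₁ + E₃ * X₂) ?_
    -- The first variation formula turns `E₁ * X₃` into `ev_{X₃}(ξ₁ X₂)`, and cyclically. The terms
    -- that differentiate some `Xᵢ` are those of the Schouten sum for the order `1, 3, 2`; those
    -- that differentiate some `ξᵢ` match it after self-adjointness exchanges the two vector fields.
    convert exactForms.add_mem (exactForms.add_mem
      (exactForms.add_mem (exactForms.add_mem (hE₁ X₃) (hE₂ X₁)) (hE₃ X₂))
      (schouten _ _ _ _ _ _ h₁ h₃ h₂)) (exactForms.add_mem (exactForms.add_mem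
        (evol_euler_symm he₁ X₃ X₂) (evol_euler_symm he₂ X₁ X₃)) (evol_euler_symm he₃ X₂ X₁))
      using 1
    simp only [Derivation.leibniz, smul_eq_mul]
    ring
  schouten ξ₁ ξ₂ ξ₃ X₁ X₂ X₃ h₁ h₂ h₃ := by
    lift ξ₁ to diffAlg using (hL _ _ h₁).1
    lift X₁ to diffAlg using (hL _ _ h₁).2
    lift ξ₂ to diffAlg using (hL _ _ h₂).1
    lift X₂ to diffAlg using (hL _ _ h₂).2
    lift ξ₃ to diffAlg using (hL _ _ h₃).1
    lift X₃ to diffAlg using (hL _ _ h₃).2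
    simpa using integralZero_of_mem_exactForms (schouten _ _ _ _ _ _ h₁ h₂ h₃)

/-! ### The operators on the algebra of differential functions -/

theorem isPrimitive_coe_iff (p f : diffAlg) :
    IsPrimitive jetCalculus (p : Jet → ℝ) f ↔ totalDer p = f := by
  constructor
  · rintro ⟨-, h⟩
    refine Subtype.ext ?_
    rw [coe_totalDer]
    exact Set.eqOn_univ _ _ |>.1 h
  · rintro rfl
    refine ⟨p.2, ?_⟩
    rw [coe_totalDer]
    exact Set.eqOn_refl _ _

theorem opH_coe_iff (h w : diffAlg) :
    opH jetCalculus (h : Jet → ℝ) w ↔ w = totalDer h := by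
  constructor
  · rintro ⟨-, -, e⟩
    refine Subtype.ext ?_
    rw [coe_totalDer]
    exact Set.eqOn_univ _ _ |>.1 e
  · rintro rfl
    refine ⟨h.2, (totalDer h).2, ?_⟩
    rw [coe_totalDer]
    exact Set.eqOn_refl _ _

theorem opJ_coe_iff (h w : diffAlg) : opJ jetCalculus (jetU 0) (h : Jet → ℝ) w ↔
    ∃ p : diffAlg, totalDer p = jetCoord 0 * h ∧ w = totalDer h - jetCoord 0 * p := by
  constructor
  · rintro ⟨p, -, -, hp, e⟩
    lift p to diffAlg using hp.1
    refine ⟨p, (isPrimitive_coe_iff p (jetCoord 0 * h)).1 hp, Subtype.ext ?_⟩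
    change (w : Jet → ℝ) = (totalDer h : Jet → ℝ) - jetU 0 * (p : Jet → ℝ)
    rw [coe_totalDer]
    exact Set.eqOn_univ _ _ |>.1 e
  · rintro ⟨p, hp, rfl⟩
    refine ⟨p, h.2, Subtype.prop _, (isPrimitive_coe_iff p (jetCoord 0 * h)).2 hp, ?_⟩
    change Set.EqOn ((totalDer h : Jet → ℝ) - jetU 0 * (p : Jet → ℝ)) _ _
    rw [coe_totalDer]
    exact Set.eqOn_refl _ _

theorem opR_coe_iff (h w : diffAlg) : opR jetCalculus (jetU 0) (h : Jet → ℝ) w ↔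
    ∃ p : diffAlg, totalDer p = jetCoord 0 * h ∧
      w = totalDer (totalDer h) - jetCoord 0 ^ 2 * h - jetCoord 1 * p := by
  have e1 : totalD (jetU 0) = jetU 1 := by
    rw [← coe_jetCoord, ← coe_totalDer, totalDer_jetCoord, coe_jetCoord]
  have e2 : ∀ p : diffAlg, ((totalDer (totalDer h) - jetCoord 0 ^ 2 * h - jetCoord 1 * p : diffAlg) :
      Jet → ℝ) = jetCalculus.D (jetCalculus.D h) - jetU 0 ^ 2 * h - jetCalculus.D (jetU 0) * p := by
    intro p
    change (totalDer (totalDer h) : Jet → ℝ) - jetU 0 ^ 2 * h - jetU 1 * p =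
      totalD (totalD h) - jetU 0 ^ 2 * h - totalD (jetU 0) * p
    rw [e1, coe_totalDer, coe_totalDer]
  constructor
  · rintro ⟨p, -, -, hp, e⟩
    lift p to diffAlg using hp.1
    exact ⟨p, (isPrimitive_coe_iff p (jetCoord 0 * h)).1 hp,
      Subtype.ext ((Set.eqOn_univ _ _ |>.1 e).trans (e2 p).symm)⟩
  · rintro ⟨p, hp, rfl⟩
    refine ⟨p, h.2, Subtype.prop _, (isPrimitive_coe_iff p (jetCoord 0 * h)).2 hp, ?_⟩
    rw [e2]
    exact Set.eqOn_refl _ _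

/-- `R = H J`. -/
theorem opH_comp_opJ :
    Op.comp (opH jetCalculus) (opJ jetCalculus (jetU 0)) = opR jetCalculus (jetU 0) := by
  have e : ∀ h p : diffAlg, totalDer p = jetCoord 0 * h →
      totalDer (totalDer h - jetCoord 0 * p) =
        totalDer (totalDer h) - jetCoord 0 ^ 2 * h - jetCoord 1 * p := by
    intro h p hp
    simp only [map_sub, Derivation.leibniz, hp, totalDer_jetCoord, smul_eq_mul]
    ring
  funext h w
  refine propext ⟨?_, ?_⟩
  · rintro ⟨v, hJ, hH⟩
    have hh : IsDiffFun h := hJ.choose_spec.1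
    lift h to diffAlg using hh
    lift v to diffAlg using hH.1
    lift w to diffAlg using hH.2.1
    rw [opH_coe_iff] at hH
    rw [opJ_coe_iff] at hJ
    obtain ⟨p, hp, rfl⟩ := hJ
    exact (opR_coe_iff _ _).2 ⟨p, hp, hH.trans (e h p hp)⟩
  · intro hR
    have hh : IsDiffFun h := hR.choose_spec.1
    have hw : IsDiffFun w := hR.choose_spec.2.1
    lift h to diffAlg using hh
    lift w to diffAlg using hw
    obtain ⟨p, hp, rfl⟩ := (opR_coe_iff _ _).1 hR
    exact ⟨_, (opJ_coe_iff _ _).2 ⟨p, hp, rfl⟩, (opH_coe_iff _ _).2 (e h p hp).symm⟩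

/-! ### Hamiltonian, symplectic and compatibility conditions. -/

theorem isHamiltonian_opH : IsHamiltonian (opH jetCalculus) := by
  refine isHamiltonian_of_exactForms (fun _ _ h => ⟨h.1, h.2.1⟩) ?_ ?_
  · intro ξ₁ ξ₂ X₁ X₂ h₁ h₂
    rw [opH_coe_iff] at h₁ h₂
    subst h₁ h₂
    refine ⟨ξ₁ * ξ₂, (totalDer.leibniz ξ₁ ξ₂)⟩
  · intro ξ₁ ξ₂ ξ₃ X₁ X₂ X₃ h₁ h₂ h₃
    rw [opH_coe_iff] at h₁ h₂ h₃
    -- `H` has coefficients independent of `u`, so it commutes with every `ev_Z`; the Schouten sum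
    -- then collapses by the Leibniz rule.
    have e₁ : ∀ Z, evol Z X₁ = totalDer (evol Z ξ₁) := fun Z => by rw [h₁, evol_totalDer]
    have e₂ : ∀ Z, evol Z X₂ = totalDer (evol Z ξ₂) := fun Z => by rw [h₂, evol_totalDer]
    have e₃ : ∀ Z, evol Z X₃ = totalDer (evol Z ξ₃) := fun Z => by rw [h₃, evol_totalDer]
    refine ⟨ξ₂ * evol X₃ ξ₁ + ξ₃ * evol X₁ ξ₂ + ξ₁ * evol X₂ ξ₃, ?_⟩
    change totalDer _ = _
    simp only [map_add, Derivation.leibniz, e₁, e₂, e₃, ← h₁, ← h₂, ← h₃, smul_eq_mul]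
    ring

section Identities

variable {A : Type*} [CommRing A] [Algebra ℝ A] (D : Derivation ℝ A A)

/-- The primitive of the Schouten bracket of `c₁ H + c₂ J⁻¹` with itself. -/
theorem schouten_comb_opH_inv_opJ (P₁ P₂ P₃ : Derivation ℝ A A)
    (k₁ : ∀ f, P₁ (D f) = D (P₁ f)) (k₂ : ∀ f, P₂ (D f) = D (P₂ f))
    (k₃ : ∀ f, P₃ (D f) = D (P₃ f)) (a b : ℝ)
    {u Y₁ Y₂ Y₃ p₁ p₂ p₃ ξ₁ ξ₂ ξ₃ X₁ X₂ X₃ : A}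
    (hu₁ : P₁ u = X₁) (hu₂ : P₂ u = X₂) (hu₃ : P₃ u = X₃)
    (hp₁ : D p₁ = u * Y₁) (hp₂ : D p₂ = u * Y₂) (hp₃ : D p₃ = u * Y₃)
    (hξ₁ : ξ₁ = D Y₁ - u * p₁) (hξ₂ : ξ₂ = D Y₂ - u * p₂) (hξ₃ : ξ₃ = D Y₃ - u * p₃)
    (hX₁ : X₁ = a • D ξ₁ + b • Y₁) (hX₂ : X₂ = a • D ξ₂ + b • Y₂)
    (hX₃ : X₃ = a • D ξ₃ + b • Y₃) :
    D (a • (ξ₂ * P₃ ξ₁ + ξ₃ * P₁ ξ₂ + ξ₁ * P₂ ξ₃) +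
      b • (P₁ Y₂ * Y₃ - P₁ p₂ * p₃ + (P₂ Y₃ * Y₁ - P₂ p₃ * p₁) + (P₃ Y₁ * Y₂ - P₃ p₁ * p₂)) +
      (a * b) • (ξ₁ * (p₃ * Y₂ - p₂ * Y₃) + ξ₂ * (p₁ * Y₃ - p₃ * Y₁) +
        ξ₃ * (p₂ * Y₁ - p₁ * Y₂))) =
      (P₁ ξ₂ * X₃ + ξ₂ * P₃ X₁) + (P₂ ξ₃ * X₁ + ξ₃ * P₁ X₂) + (P₃ ξ₁ * X₂ + ξ₁ * P₂ X₃) := by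
  have q₁ : ∀ P : Derivation ℝ A A, (∀ f, P (D f) = D (P f)) →
      D (P p₁) = P u * Y₁ + u * P Y₁ ∧ D (P p₂) = P u * Y₂ + u * P Y₂ ∧
      D (P p₃) = P u * Y₃ + u * P Y₃ := by
    intro P hP
    simp only [← hP, hp₁, hp₂, hp₃, Derivation.leibniz, smul_eq_mul]
    refine ⟨?_, ?_, ?_⟩ <;> ring
  have hξ : ∀ P : Derivation ℝ A A, (∀ f, P (D f) = D (P f)) →
      P ξ₁ = D (P Y₁) - P u * p₁ - u * P p₁ ∧ P ξ₂ = D (P Y₂) - P u * p₂ - u * P p₂ ∧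
      P ξ₃ = D (P Y₃) - P u * p₃ - u * P p₃ := by
    intro P hP
    simp only [hξ₁, hξ₂, hξ₃, map_sub, hP, Derivation.leibniz, smul_eq_mul]
    refine ⟨?_, ?_, ?_⟩ <;> ring
  have hX : ∀ P : Derivation ℝ A A, (∀ f, P (D f) = D (P f)) →
      P X₁ = a • D (P ξ₁) + b • P Y₁ ∧ P X₂ = a • D (P ξ₂) + b • P Y₂ ∧
      P X₃ = a • D (P ξ₃) + b • P Y₃ := by
    intro P hP
    simp only [hX₁, hX₂, hX₃, map_add, Derivation.map_smul, hP, and_self]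
  obtain ⟨x₁₁, x₁₂, x₁₃⟩ := hX P₁ k₁
  obtain ⟨x₂₁, x₂₂, x₂₃⟩ := hX P₂ k₂
  obtain ⟨x₃₁, x₃₂, x₃₃⟩ := hX P₃ k₃
  obtain ⟨y₁₁, y₁₂, y₁₃⟩ := hξ P₁ k₁
  obtain ⟨y₂₁, y₂₂, y₂₃⟩ := hξ P₂ k₂
  obtain ⟨y₃₁, y₃₂, y₃₃⟩ := hξ P₃ k₃
  obtain ⟨z₁₁, z₁₂, z₁₃⟩ := q₁ P₁ k₁
  obtain ⟨z₂₁, z₂₂, z₂₃⟩ := q₁ P₂ k₂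
  obtain ⟨z₃₁, z₃₂, z₃₃⟩ := q₁ P₃ k₃
  rw [x₁₂, x₂₃, x₃₁]
  simp only [map_add, map_sub, Derivation.map_smul, Derivation.leibniz, smul_eq_mul, hp₁, hp₂, hp₃,
    z₁₂, z₂₃, z₃₁]
  -- Eliminate `D Yᵢ` and `D (Pᵢ Yⱼ)` in favour of `ξ`. Beyond the wanted terms, the `b` part of the
  -- primitive leaves `b X₁ (p₂ Y₃ - p₃ Y₂)` and its cyclic images. With `X = a D ξ + b Y`, the `Y`
  -- contribution cancels cyclically, and the `a b` part of the primitive cancels the `D ξ`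
  -- contribution.
  have d₁ : D Y₁ = ξ₁ + u * p₁ := by rw [hξ₁]; ring
  have d₂ : D Y₂ = ξ₂ + u * p₂ := by rw [hξ₂]; ring
  have d₃ : D Y₃ = ξ₃ + u * p₃ := by rw [hξ₃]; ring
  have v₁₂ : D (P₁ Y₂) = P₁ ξ₂ + X₁ * p₂ + u * P₁ p₂ := by rw [y₁₂, hu₁]; ring
  have v₂₃ : D (P₂ Y₃) = P₂ ξ₃ + X₂ * p₃ + u * P₂ p₃ := by rw [y₂₃, hu₂]; ring
  have v₃₁ : D (P₃ Y₁) = P₃ ξ₁ + X₃ * p₁ + u * P₃ p₁ := by rw [y₃₁, hu₃]; ring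
  rw [v₁₂, v₂₃, v₃₁, d₁, d₂, d₃, hu₁, hu₂, hu₃]
  rw [hX₁, hX₂, hX₃]
  simp only [Algebra.smul_def, map_mul]
  ring

/-- The primitive of the Schouten bracket of `(c₁ H⁻¹ + c₂ J)⁻¹` with itself. -/
theorem schouten_inv_comb_inv_opH_opJ (P₁ P₂ P₃ : Derivation ℝ A A)
    (k₁ : ∀ f, P₁ (D f) = D (P₁ f)) (k₂ : ∀ f, P₂ (D f) = D (P₂ f))
    (k₃ : ∀ f, P₃ (D f) = D (P₃ f)) (a b : ℝ)
    {u p₁ p₂ p₃ v₁ v₂ v₃ ξ₁ ξ₂ ξ₃ X₁ X₂ X₃ : A}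
    (hu₁ : P₁ u = X₁) (hu₂ : P₂ u = X₂) (hu₃ : P₃ u = X₃)
    (hp₁ : D p₁ = u * X₁) (hp₂ : D p₂ = u * X₂) (hp₃ : D p₃ = u * X₃)
    (hX₁ : X₁ = D v₁) (hX₂ : X₂ = D v₂) (hX₃ : X₃ = D v₃)
    (hξ₁ : ξ₁ = a • v₁ + b • (D X₁ - u * p₁)) (hξ₂ : ξ₂ = a • v₂ + b • (D X₂ - u * p₂))
    (hξ₃ : ξ₃ = a • v₃ + b • (D X₃ - u * p₃)) :
    D (a • (v₂ * P₃ v₁ + v₃ * P₁ v₂ + v₁ * P₂ v₃) +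
      b • (P₁ X₂ * X₃ - P₁ p₂ * p₃ + (P₂ X₃ * X₁ - P₂ p₃ * p₁) + (P₃ X₁ * X₂ - P₃ p₁ * p₂))) =
      (P₁ ξ₂ * X₃ + ξ₂ * P₃ X₁) + (P₂ ξ₃ * X₁ + ξ₃ * P₁ X₂) + (P₃ ξ₁ * X₂ + ξ₁ * P₂ X₃) := by
  have z₁₂ : D (P₁ p₂) = X₁ * X₂ + u * P₁ X₂ := by
    rw [← k₁, hp₂, Derivation.leibniz, hu₁, smul_eq_mul, smul_eq_mul]; ring
  have z₂₃ : D (P₂ p₃) = X₂ * X₃ + u * P₂ X₃ := by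
    rw [← k₂, hp₃, Derivation.leibniz, hu₂, smul_eq_mul, smul_eq_mul]; ring
  have z₃₁ : D (P₃ p₁) = X₃ * X₁ + u * P₃ X₁ := by
    rw [← k₃, hp₁, Derivation.leibniz, hu₃, smul_eq_mul, smul_eq_mul]; ring
  have w₁₂ : D (P₁ v₂) = P₁ X₂ := by rw [← k₁, hX₂]
  have w₂₃ : D (P₂ v₃) = P₂ X₃ := by rw [← k₂, hX₃]
  have w₃₁ : D (P₃ v₁) = P₃ X₁ := by rw [← k₃, hX₁]
  -- No `a b` term is needed here: closedness of a two-form is linear in the operator from vector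
  -- fields to covectors, so the `H⁻¹` and `J` contributions close separately.
  rw [hξ₁, hξ₂, hξ₃]
  simp only [map_add, map_sub, Derivation.map_smul, Derivation.leibniz, smul_eq_mul, hp₁, hp₂, hp₃,
    z₁₂, z₂₃, z₃₁, w₁₂, w₂₃, w₃₁, hu₁, hu₂, hu₃, k₁, k₂, k₃, ← hX₁, ← hX₂, ← hX₃]
  simp only [Algebra.smul_def]
  ring

end Identities

/-- Parametrizing by `Y` and a primitive `p` of `u Y` avoids inverting `J`. Only inclusion of `L` in
the parametrized relation is needed, so one criterion serves both `J⁻¹` and the combinations `c₁ H +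
c₂ J⁻¹`. -/
theorem isHamiltonian_of_comb_opH_inv_opJ (a b : ℝ) {L : Op Jet}
    (hL : ∀ ξ X, L ξ X → IsDiffFun ξ ∧ IsDiffFun X)
    (h : ∀ ξ X : diffAlg, L ξ X → ∃ Y p : diffAlg, totalDer p = jetCoord 0 * Y ∧
      ξ = totalDer Y - jetCoord 0 * p ∧ X = a • totalDer ξ + b • Y) : IsHamiltonian L := by
  refine isHamiltonian_of_exactForms hL ?_ ?_
  · intro ξ₁ ξ₂ X₁ X₂ h₁ h₂
    obtain ⟨Y₁, p₁, hp₁, hξ₁, rfl⟩ := h _ _ h₁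
    obtain ⟨Y₂, p₂, hp₂, hξ₂, rfl⟩ := h _ _ h₂
    -- In the nonlocal part, `u p₁ Y₂ + u p₂ Y₁ = p₁ D_x p₂ + p₂ D_x p₁` is the total derivative of
    -- `p₁ p₂`.
    refine ⟨a • (ξ₁ * ξ₂) + b • (Y₁ * Y₂ - p₁ * p₂), ?_⟩
    change totalDer _ = _
    have d₁ : totalDer Y₁ = ξ₁ + jetCoord 0 * p₁ := by rw [hξ₁]; ring
    have d₂ : totalDer Y₂ = ξ₂ + jetCoord 0 * p₂ := by rw [hξ₂]; ring
    simp only [map_add, map_sub, Derivation.map_smul, Derivation.leibniz, smul_eq_mul, hp₁, hp₂,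
      d₁, d₂]
    simp only [Algebra.smul_def]
    ring
  · intro ξ₁ ξ₂ ξ₃ X₁ X₂ X₃ h₁ h₂ h₃
    obtain ⟨Y₁, p₁, hp₁, hξ₁, hX₁⟩ := h _ _ h₁
    obtain ⟨Y₂, p₂, hp₂, hξ₂, hX₂⟩ := h _ _ h₂
    obtain ⟨Y₃, p₃, hp₃, hξ₃, hX₃⟩ := h _ _ h₃
    exact ⟨_, schouten_comb_opH_inv_opJ totalDer (evol X₁) (evol X₂) (evol X₃) (evol_totalDer _)
      (evol_totalDer _) (evol_totalDer _) a b (evol_jetCoord_zero _) (evol_jetCoord_zero _)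
      (evol_jetCoord_zero _) hp₁ hp₂ hp₃ hξ₁ hξ₂ hξ₃ hX₁ hX₂ hX₃⟩

theorem isSymplectic_opJ : IsSymplectic (opJ jetCalculus (jetU 0)) := by
  refine isHamiltonian_of_comb_opH_inv_opJ 0 1 ?_ ?_
  · rintro ξ X ⟨p, hX, hξ, -⟩
    exact ⟨hξ, hX⟩
  · intro ξ X h
    obtain ⟨p, hp, hξ⟩ := (opJ_coe_iff X ξ).1 h
    exact ⟨X, p, hp, hξ, by simp⟩

theorem isHamiltonian_comb_opH_inv_opJ (a b : ℝ) :
    IsHamiltonian (Op.comb a (opH jetCalculus) b (opJ jetCalculus (jetU 0)).inv) := by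
  refine isHamiltonian_of_comb_opH_inv_opJ a b ?_ ?_
  · rintro ξ X ⟨w₁, w₂, hH, ⟨p, hJ, -⟩, rfl⟩
    exact ⟨hH.1, diffAlg.add_mem (diffAlg.smul_mem hH.2.1 a) (diffAlg.smul_mem hJ b)⟩
  · rintro ξ X ⟨w₁, w₂, hH, hJ, hX⟩
    lift w₁ to diffAlg using hH.2.1
    lift w₂ to diffAlg using hJ.choose_spec.1
    obtain ⟨p, hp, hξ⟩ := (opJ_coe_iff w₂ ξ).1 hJ
    exact ⟨w₂, p, hp, hξ, Subtype.ext (by rw [hX, (opH_coe_iff _ _).1 hH]; rfl)⟩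

theorem isSymplectic_comb_inv_opH_opJ (a b : ℝ) :
    IsSymplectic (Op.comb a (opH jetCalculus).inv b (opJ jetCalculus (jetU 0))) := by
  have key : ∀ ξ X : diffAlg,
      (Op.comb a (opH jetCalculus).inv b (opJ jetCalculus (jetU 0))).inv (ξ : Jet → ℝ) X →
      ∃ v p : diffAlg, X = totalDer v ∧ totalDer p = jetCoord 0 * X ∧
        ξ = a • v + b • (totalDer X - jetCoord 0 * p) := by
    rintro ξ X ⟨w₁, w₂, hH, hJ, hξ⟩
    lift w₁ to diffAlg using hH.1
    lift w₂ to diffAlg using hJ.choose_spec.2.1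
    obtain ⟨p, hp, hw⟩ := (opJ_coe_iff X w₂).1 hJ
    exact ⟨w₁, p, (opH_coe_iff _ _).1 hH, hp, Subtype.ext (by rw [hξ, hw]; rfl)⟩
  refine isHamiltonian_of_exactForms ?_ ?_ ?_
  · rintro ξ X ⟨w₁, w₂, hH, ⟨p, hJ⟩, rfl⟩
    exact ⟨diffAlg.add_mem (diffAlg.smul_mem hH.1 a) (diffAlg.smul_mem hJ.2.1 b), hJ.1⟩
  · intro ξ₁ ξ₂ X₁ X₂ h₁ h₂
    obtain ⟨v₁, p₁, hX₁, hp₁, rfl⟩ := key _ _ h₁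
    obtain ⟨v₂, p₂, hX₂, hp₂, rfl⟩ := key _ _ h₂
    refine ⟨a • (v₁ * v₂) + b • (X₁ * X₂ - p₁ * p₂), ?_⟩
    change totalDer _ = _
    simp only [map_add, map_sub, Derivation.map_smul, Derivation.leibniz, smul_eq_mul, hp₁, hp₂,
      ← hX₁, ← hX₂]
    simp only [Algebra.smul_def]
    ring
  · intro ξ₁ ξ₂ ξ₃ X₁ X₂ X₃ h₁ h₂ h₃
    obtain ⟨v₁, p₁, hX₁, hp₁, hξ₁⟩ := key _ _ h₁
    obtain ⟨v₂, p₂, hX₂, hp₂, hξ₂⟩ := key _ _ h₂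
    obtain ⟨v₃, p₃, hX₃, hp₃, hξ₃⟩ := key _ _ h₃
    exact ⟨_, schouten_inv_comb_inv_opH_opJ totalDer (evol X₁) (evol X₂) (evol X₃)
      (evol_totalDer _) (evol_totalDer _) (evol_totalDer _) a b (evol_jetCoord_zero _)
      (evol_jetCoord_zero _) (evol_jetCoord_zero _) hp₁ hp₂ hp₃ hX₁ hX₂ hX₃ hξ₁ hξ₂ hξ₃⟩

theorem isCompatiblePair_opH_opJ :
    IsCompatiblePair (opH jetCalculus) (opJ jetCalculus (jetU 0)) := fun a b =>
  ⟨isHamiltonian_comb_opH_inv_opJ a b, isSymplectic_comb_inv_opH_opJ a b⟩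

/-! ### The recursion operator -/

section Identities

variable {A : Type*} [CommRing A] [Algebra ℝ A] (D : Derivation ℝ A A)

/-- Supplies the value of `D_x⁻¹(u [X, Y])` that selects `W = R[X, Y]`; the cross terms `X Y`
cancel. -/
theorem nijenhuis_primitive (P Q : Derivation ℝ A A)
    (kP : ∀ f, P (D f) = D (P f)) (kQ : ∀ f, Q (D f) = D (Q f)) {u X Y p q : A}
    (hP : P u = X) (hQ : Q u = Y) (hp : D p = u * X) (hq : D q = u * Y) :
    D (P q - Q p) = u * (P Y - Q X) := by
  rw [map_sub, ← kP, ← kQ, hp, hq]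
  simp only [Derivation.leibniz, hP, hQ, smul_eq_mul]
  ring

/-- With this choice of `W`, it cancels against `P Y' - Q X'` except for the terms in which `D u`
was varied, namely `p D Y - q D X`. -/
theorem nijenhuis_argument (P Q P' Q' : Derivation ℝ A A)
    (kP : ∀ f, P (D f) = D (P f)) (kQ : ∀ f, Q (D f) = D (Q f)) {u X Y X' Y' p q : A}
    (hP : P u = X) (hQ : Q u = Y)
    (hX' : X' = D (D X) - u ^ 2 * X - D u * p) (hY' : Y' = D (D Y) - u ^ 2 * Y - D u * q) :
    (P' Y - Q X') + (P Y' - Q' X) -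
      (D (D (P Y - Q X)) - u ^ 2 * (P Y - Q X) - D u * (P q - Q p)) =
      P' Y - Q' X - q * D X + p * D Y := by
  rw [hX', hY']
  simp only [map_sub, Derivation.leibniz, Derivation.leibniz_pow, kP, kQ, hP, hQ, smul_eq_mul,
    nsmul_eq_mul]
  push_cast
  ring

/-- The primitive for the outer `R`. Differentiating `P' q - Q' p` leaves `X' Y - Y' X`; its
second-order part is removed by `X D Y - Y D X`, its nonlocal part by `u (p Y - q X)`. -/
theorem nijenhuis_primitive_argument (P' Q' : Derivation ℝ A A)
    (kP' : ∀ f, P' (D f) = D (P' f)) (kQ' : ∀ f, Q' (D f) = D (Q' f)) {u X Y X' Y' p q : A}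
    (hP' : P' u = X') (hQ' : Q' u = Y') (hp : D p = u * X) (hq : D q = u * Y)
    (hX' : X' = D (D X) - u ^ 2 * X - D u * p) (hY' : Y' = D (D Y) - u ^ 2 * Y - D u * q) :
    D (P' q - Q' p + X * D Y - Y * D X + u * (p * Y - q * X)) =
      u * (P' Y - Q' X - q * D X + p * D Y) := by
  simp only [map_add, map_sub, ← kP', ← kQ', Derivation.leibniz, hp, hq, hP', hQ', smul_eq_mul]
  rw [hX', hY']
  ring

theorem nijenhuis_value (P' Q' : Derivation ℝ A A)
    (kP' : ∀ f, P' (D f) = D (P' f)) (kQ' : ∀ f, Q' (D f) = D (Q' f)) {u X Y X' Y' p q : A}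
    (hP' : P' u = X') (hQ' : Q' u = Y') (hp : D p = u * X) (hq : D q = u * Y)
    (hX' : X' = D (D X) - u ^ 2 * X - D u * p) (hY' : Y' = D (D Y) - u ^ 2 * Y - D u * q) :
    P' Y' - Q' X' = D (D (P' Y - Q' X - q * D X + p * D Y)) -
      u ^ 2 * (P' Y - Q' X - q * D X + p * D Y) -
      D u * (P' q - Q' p + X * D Y - Y * D X + u * (p * Y - q * X)) := by
  have e₁ : P' Y' = D (D (P' Y)) - 2 * u * X' * Y - u ^ 2 * P' Y - D X' * q - D u * P' q := by
    rw [hY']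
    simp only [map_sub, Derivation.leibniz, Derivation.leibniz_pow, kP', hP', smul_eq_mul,
      nsmul_eq_mul]
    push_cast
    ring
  have e₂ : Q' X' = D (D (Q' X)) - 2 * u * Y' * X - u ^ 2 * Q' X - D Y' * p - D u * Q' p := by
    rw [hX']
    simp only [map_sub, Derivation.leibniz, Derivation.leibniz_pow, kQ', hQ', smul_eq_mul,
      nsmul_eq_mul]
    push_cast
    ring
  rw [e₁, e₂, hX', hY']
  simp only [map_add, map_sub, Derivation.leibniz, Derivation.leibniz_pow, hp, hq, smul_eq_mul,
    nsmul_eq_mul]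
  push_cast
  ring

end Identities

theorem isHereditary_opR : IsHereditary (opR jetCalculus (jetU 0)) := by
  intro X Y X' Y' hX hY
  lift X to diffAlg using hX.choose_spec.1
  lift X' to diffAlg using hX.choose_spec.2.1
  lift Y to diffAlg using hY.choose_spec.1
  lift Y' to diffAlg using hY.choose_spec.2.1
  obtain ⟨p, hp, hX'⟩ := (opR_coe_iff _ _).1 hX
  obtain ⟨q, hq, hY'⟩ := (opR_coe_iff _ _).1 hY
  rw [← totalDer_jetCoord] at hX' hY'
  simp only [coe_bracket]
  refine ⟨_, (opR_coe_iff _ _).2 ⟨evol X q - evol Y p, nijenhuis_primitive totalDer _ _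
    (evol_totalDer X) (evol_totalDer Y) (evol_jetCoord_zero X) (evol_jetCoord_zero Y) hp hq, rfl⟩,
    ?_⟩
  have e := nijenhuis_argument totalDer (evol X) (evol Y) (evol X') (evol Y')
    (evol_totalDer X) (evol_totalDer Y) (evol_jetCoord_zero X) (evol_jetCoord_zero Y) hX' hY'
  rw [totalDer_jetCoord] at e
  have h : opR jetCalculus (jetU 0) ((evol X' Y - evol Y' X - q * totalDer X + p * totalDer Y :
      diffAlg) : Jet → ℝ) ((evol X' Y' - evol Y' X' : diffAlg) : Jet → ℝ) := by
    refine (opR_coe_iff _ _).2 ⟨_, nijenhuis_primitive_argument totalDer _ _ (evol_totalDer X')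
      (evol_totalDer Y') (evol_jetCoord_zero X') (evol_jetCoord_zero Y') hp hq hX' hY', ?_⟩
    rw [← totalDer_jetCoord]
    exact nijenhuis_value totalDer _ _ (evol_totalDer X') (evol_totalDer Y')
      (evol_jetCoord_zero X') (evol_jetCoord_zero Y') hp hq hX' hY'
  rw [← e] at h
  exact h

/-! ### Invariance of the recursion operator along `u_x` and the mKdV field. -/

theorem isRecursionOperatorOf_opR_jetU_one :
    IsRecursionOperatorOf (opR jetCalculus (jetU 0)) (jetU 1) := by
  intro X X' hX
  lift X to diffAlg using hX.choose_spec.1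
  lift X' to diffAlg using hX.choose_spec.2.1
  obtain ⟨p, hp, rfl⟩ := (opR_coe_iff _ _).1 hX
  rw [← coe_jetCoord 1, coe_bracket, coe_bracket]
  have e : ∀ Z, evol Z (jetCoord 1) = totalDer Z := fun Z => evol_jetCoord Z 1
  -- Here `[u_x, X] = ev X - D_x X = -∂X/∂x`, and the chosen primitive is likewise `ev p - D_x p =
  -- -∂p/∂x`.
  refine (opR_coe_iff _ _).2 ⟨evol (jetCoord 1) p - jetCoord 0 * X, ?_, ?_⟩
  · simp only [map_sub, ← evol_totalDer, hp, Derivation.leibniz, evol_jetCoord_zero, e,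
      totalDer_jetCoord, smul_eq_mul]
    ring
  · simp only [map_sub, evol_totalDer, hp, Derivation.leibniz, Derivation.leibniz_pow,
      evol_jetCoord_zero, e, totalDer_jetCoord, smul_eq_mul, nsmul_eq_mul]
    push_cast
    ring

/-- The right-hand side of the defocusing mKdV equation. -/
def mkdvField : diffAlg := jetCoord 3 - (3 / 2 : ℝ) • (jetCoord 0 ^ 2 * jetCoord 1)

theorem coe_mkdvField :
    (mkdvField : Jet → ℝ) = jetU 3 - (3 / 2 : ℝ) • (jetU 0 ^ 2 * jetU 1) := rfl

theorem opR_jetU_one : opR jetCalculus (jetU 0) (jetU 1)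
    (jetU 3 - (3 / 2 : ℝ) • (jetU 0 ^ 2 * jetU 1)) := by
  rw [← coe_mkdvField, ← coe_jetCoord 1]
  have h : (2 : diffAlg) * algebraMap ℝ diffAlg (1 / 2) = 1 := by
    rw [← map_ofNat (algebraMap ℝ diffAlg) 2, ← map_mul]
    norm_num
  have h3 : algebraMap ℝ diffAlg (3 / 2) = 3 * algebraMap ℝ diffAlg (1 / 2) := by
    rw [← map_ofNat (algebraMap ℝ diffAlg) 3, ← map_mul]
    norm_num
  -- `u u_x = D_x(u²/2)`, and the primitive `u²/2` turns the coefficient `-1` of `u² u_x` into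
  -- `-3/2`.
  refine (opR_coe_iff _ _).2 ⟨(1 / 2 : ℝ) • jetCoord 0 ^ 2, ?_, ?_⟩
  · simp only [Derivation.map_smul, Derivation.leibniz_pow, totalDer_jetCoord, smul_eq_mul,
      nsmul_eq_mul]
    rw [Algebra.smul_def]
    push_cast
    linear_combination (jetCoord 0 * jetCoord 1) * h
  · simp only [mkdvField, totalDer_jetCoord, Algebra.smul_def, h3]
    linear_combination (-jetCoord 0 ^ 2 * jetCoord 1) * h

theorem isRecursionOperatorOf_opR_mkdv : IsRecursionOperatorOf (opR jetCalculus (jetU 0))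
    (jetU 3 - (3 / 2 : ℝ) • (jetU 0 ^ 2 * jetU 1)) := by
  intro X X' hX
  lift X to diffAlg using hX.choose_spec.1
  lift X' to diffAlg using hX.choose_spec.2.1
  obtain ⟨p, hp, rfl⟩ := (opR_coe_iff _ _).1 hX
  rw [← coe_mkdvField, coe_bracket, coe_bracket]
  -- The scalar `3/2` becomes a ring element `c` killed by derivations, so that `ring` treats it as
  -- an atom and `2 * c = 3` enters through `linear_combination`.
  obtain ⟨c, hc, e, hc0⟩ : ∃ c : diffAlg, 2 * c = 3 ∧ (∀ f : diffAlg, (3 / 2 : ℝ) • f = c * f) ∧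
      ∀ d : Derivation ℝ diffAlg diffAlg, d c = 0 := by
    refine ⟨algebraMap ℝ diffAlg (3 / 2), ?_, fun f => Algebra.smul_def _ _,
      fun d => d.map_algebraMap _⟩
    rw [← map_ofNat (algebraMap ℝ diffAlg) 2, ← map_mul, ← map_ofNat (algebraMap ℝ diffAlg) 3]
    norm_num
  have e₁ : ∀ Z, evol Z (jetCoord 1) = totalDer Z := fun Z => evol_jetCoord Z 1
  have e₃ : ∀ Z, evol Z (jetCoord 3) = totalDer (totalDer (totalDer Z)) :=
    fun Z => evol_jetCoord Z 3
  have eK : ∀ Z, evol Z mkdvField = totalDer (totalDer (totalDer Z)) -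
      3 * jetCoord 0 * jetCoord 1 * Z - c * jetCoord 0 ^ 2 * totalDer Z := by
    intro Z
    simp only [mkdvField, map_sub, hc0, e, Derivation.leibniz,
      Derivation.leibniz_pow, evol_jetCoord_zero, e₁, e₃, smul_eq_mul, nsmul_eq_mul]
    push_cast
    linear_combination (-jetCoord 0 * jetCoord 1 * Z) * hc
  have hK : mkdvField = jetCoord 3 - c * (jetCoord 0 ^ 2 * jetCoord 1) := by rw [mkdvField, e]
  have h3 : totalDer 3 = 0 := mod_cast totalDer.map_natCast 3
  -- With `K` the mKdV field, `u K` is the total derivative of `F = u u_xx - u_x²/2 - (3/8) u⁴`.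
  -- Since `u [K, X] = D_x(ev_K p) - ev_X(u K)`, a primitive is `ev_K p - ev_X F`, the witness
  -- given.
  refine (opR_coe_iff _ _).2 ⟨evol mkdvField p - (jetCoord 2 * X - jetCoord 1 * totalDer X +
    jetCoord 0 * totalDer (totalDer X)) + c * (jetCoord 0 ^ 3 * X), ?_, ?_⟩
  · simp only [map_sub, map_add, ← evol_totalDer, hp, Derivation.leibniz, Derivation.leibniz_pow,
      evol_jetCoord_zero, totalDer_jetCoord, smul_eq_mul, nsmul_eq_mul, eK, hc0]
    rw [hK]
    push_cast
    linear_combination (jetCoord 0 ^ 2 * jetCoord 1 * X) * hc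
  · simp only [map_sub, evol_totalDer, hp, pow_two, Derivation.leibniz, eK, evol_jetCoord_zero, e₁,
      totalDer_jetCoord, smul_eq_mul]
    rw [hK]
    simp only [map_sub, map_add, hp, hc0, pow_succ, pow_zero, one_mul, Derivation.leibniz,
      totalDer_jetCoord, smul_eq_mul, h3, map_zero]
    linear_combination (-2 * jetCoord 0 * jetCoord 1 * totalDer (totalDer X) +
      jetCoord 0 * jetCoord 1 ^ 2 * p - jetCoord 0 * jetCoord 2 * totalDer X -
      jetCoord 1 ^ 2 * totalDer X) * hc

/-! ### Partial derivatives of functions smooth on an open region -/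

section Partial

variable {E : Type*} [NormedAddCommGroup E] [NormedSpace ℝ E] {U : Set (ℝ × ℝ)} {f g : ℝ × ℝ → E}
  {z : ℝ × ℝ}

theorem hasFDerivAt_of_contDiffOn (hU : IsOpen U) (hf : ContDiffOn ℝ ∞ f U) (hz : z ∈ U) :
    HasFDerivAt f (fderiv ℝ f z) z :=
  ((hf.contDiffAt (hU.mem_nhds hz)).differentiableAt (by simp)).hasFDerivAt

theorem hasDerivAt_dx (hU : IsOpen U) (hf : ContDiffOn ℝ ∞ f U) (hz : z ∈ U) :
    HasDerivAt (fun s => f (z.1, s)) (dx f z) z.2 := by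
  have hc : HasDerivAt (fun s : ℝ => (z.1, s)) ((0 : ℝ), (1 : ℝ)) z.2 :=
    (hasDerivAt_const z.2 z.1).prodMk (hasDerivAt_id' z.2)
  exact ((hasFDerivAt_of_contDiffOn hU hf hz).comp_hasDerivAt z.2 hc).differentiableAt.hasDerivAt

theorem hasDerivAt_dt (hU : IsOpen U) (hf : ContDiffOn ℝ ∞ f U) (hz : z ∈ U) :
    HasDerivAt (fun s => f (s, z.2)) (dt f z) z.1 := by
  have hc : HasDerivAt (fun s : ℝ => (s, z.2)) ((1 : ℝ), (0 : ℝ)) z.1 :=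
    (hasDerivAt_id' z.1).prodMk (hasDerivAt_const z.1 z.2)
  exact ((hasFDerivAt_of_contDiffOn hU hf hz).comp_hasDerivAt z.1 hc).differentiableAt.hasDerivAt

theorem dx_eq_fderiv (hU : IsOpen U) (hf : ContDiffOn ℝ ∞ f U) (hz : z ∈ U) :
    dx f z = fderiv ℝ f z (0, 1) := by
  have hc : HasDerivAt (fun s : ℝ => (z.1, s)) ((0 : ℝ), (1 : ℝ)) z.2 :=
    (hasDerivAt_const z.2 z.1).prodMk (hasDerivAt_id' z.2)
  exact ((hasFDerivAt_of_contDiffOn hU hf hz).comp_hasDerivAt z.2 hc).deriv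

theorem dt_eq_fderiv (hU : IsOpen U) (hf : ContDiffOn ℝ ∞ f U) (hz : z ∈ U) :
    dt f z = fderiv ℝ f z (1, 0) := by
  have hc : HasDerivAt (fun s : ℝ => (s, z.2)) ((1 : ℝ), (0 : ℝ)) z.1 :=
    (hasDerivAt_id' z.1).prodMk (hasDerivAt_const z.1 z.2)
  exact ((hasFDerivAt_of_contDiffOn hU hf hz).comp_hasDerivAt z.1 hc).deriv

theorem contDiffOn_fderiv_apply (hU : IsOpen U) (hf : ContDiffOn ℝ ∞ f U) (v : ℝ × ℝ) :
    ContDiffOn ℝ ∞ (fun z => fderiv ℝ f z v) U :=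
  (hf.fderiv_of_isOpen hU (m := ∞) (by simp)).clm_apply contDiffOn_const

theorem contDiffOn_dx (hU : IsOpen U) (hf : ContDiffOn ℝ ∞ f U) : ContDiffOn ℝ ∞ (dx f) U :=
  (contDiffOn_fderiv_apply hU hf (0, 1)).congr fun _ hz => dx_eq_fderiv hU hf hz

theorem contDiffOn_dt (hU : IsOpen U) (hf : ContDiffOn ℝ ∞ f U) : ContDiffOn ℝ ∞ (dt f) U :=
  (contDiffOn_fderiv_apply hU hf (1, 0)).congr fun _ hz => dt_eq_fderiv hU hf hz

theorem dx_congr (hU : IsOpen U) (h : Set.EqOn f g U) : Set.EqOn (dx f) (dx g) U := by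
  intro z hz
  have hc : Continuous fun s : ℝ => (z.1, s) := by fun_prop
  refine Filter.EventuallyEq.deriv_eq ?_
  filter_upwards [hc.continuousAt.preimage_mem_nhds (hU.mem_nhds hz)] with s hs using h hs

theorem dt_congr (hU : IsOpen U) (h : Set.EqOn f g U) : Set.EqOn (dt f) (dt g) U := by
  intro z hz
  have hc : Continuous fun s : ℝ => (s, z.2) := by fun_prop
  refine Filter.EventuallyEq.deriv_eq ?_
  filter_upwards [hc.continuousAt.preimage_mem_nhds (hU.mem_nhds hz)] with s hs using h hs

theorem dt_dx_comm (hU : IsOpen U) (hf : ContDiffOn ℝ ∞ f U) (hz : z ∈ U) :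
    dt (dx f) z = dx (dt f) z := by
  have hd : DifferentiableAt ℝ (fderiv ℝ f) z :=
    ((hf.fderiv_of_isOpen hU (m := ∞) (by simp)).contDiffAt (hU.mem_nhds hz)).differentiableAt
      (by simp)
  have key : ∀ v w : ℝ × ℝ,
      fderiv ℝ (fun y => fderiv ℝ f y v) z w = fderiv ℝ (fderiv ℝ f) z w v := by
    intro v w
    rw [fderiv_clm_apply hd (differentiableAt_const v)]
    simp
  rw [dt_congr hU (fun _ hz => dx_eq_fderiv hU hf hz) hz,
    dx_congr hU (fun _ hz => dt_eq_fderiv hU hf hz) hz,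
    dt_eq_fderiv hU (contDiffOn_fderiv_apply hU hf _) hz,
    dx_eq_fderiv hU (contDiffOn_fderiv_apply hU hf _) hz, key, key]
  exact ((contDiffOn_infty.1 hf 2).contDiffAt (hU.mem_nhds hz)).isSymmSndFDerivAt (by simp) _ _

theorem dx_add (hU : IsOpen U) (hf : ContDiffOn ℝ ∞ f U) (hg : ContDiffOn ℝ ∞ g U) (hz : z ∈ U) :
    dx (f + g) z = dx f z + dx g z :=
  ((hasDerivAt_dx hU hf hz).add (hasDerivAt_dx hU hg hz)).deriv

theorem dx_smul {a : ℝ × ℝ → ℝ} (hU : IsOpen U) (ha : ContDiffOn ℝ ∞ a U)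
    (hf : ContDiffOn ℝ ∞ f U) (hz : z ∈ U) : dx (a • f) z = a z • dx f z + dx a z • f z :=
  ((hasDerivAt_dx hU ha hz).smul (hasDerivAt_dx hU hf hz)).deriv

theorem dt_smul {a : ℝ × ℝ → ℝ} (hU : IsOpen U) (ha : ContDiffOn ℝ ∞ a U)
    (hf : ContDiffOn ℝ ∞ f U) (hz : z ∈ U) : dt (a • f) z = a z • dt f z + dt a z • f z :=
  ((hasDerivAt_dt hU ha hz).smul (hasDerivAt_dt hU hf hz)).deriv

end Partial

/-! ### The Frenet frame -/

theorem eta_hodge_self (v : ℝ × ℝ) : eta (hodge v) (hodge v) = -eta v v := by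
  simp only [eta, hodge]; ring

/-- Decomposition of a vector in an orthogonal frame `T, *T`. -/
theorem eq_frame_components {T v : ℝ × ℝ} (h : eta T T ≠ 0) :
    v = (eta v T / eta T T) • T +
      (eta v (hodge T) / eta (hodge T) (hodge T)) • hodge T := by
  rw [eta_hodge_self]
  obtain ⟨a, b⟩ := T
  obtain ⟨x, y⟩ := v
  simp only [eta, hodge] at h ⊢
  -- Naming the inverse of `η(T,T)` makes both coordinates polynomial identities modulo `η(T,T) * i
  -- = 1`.
  rw [div_neg, neg_smul, div_eq_mul_inv, div_eq_mul_inv]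
  have hi := mul_inv_cancel₀ h
  set i := (-(a * a) + b * b)⁻¹
  refine Prod.ext ?_ ?_
  · simp only [Prod.fst_add, Prod.fst_neg, Prod.smul_fst, smul_eq_mul]
    linear_combination -x * hi
  · simp only [Prod.snd_add, Prod.snd_neg, Prod.smul_snd, smul_eq_mul]
    linear_combination -y * hi

/-- The components in a non-null frame `T, *T` are unique. -/
theorem frame_components_injective {T : ℝ × ℝ} (h : eta T T ≠ 0) {a b c d : ℝ}
    (e : a • T + b • hodge T = c • T + d • hodge T) : a = c ∧ b = d := by
  obtain ⟨x, y⟩ := T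
  simp only [eta, hodge] at h e
  have e₁ := congrArg Prod.fst e
  have e₂ := congrArg Prod.snd e
  simp only [Prod.fst_add, Prod.snd_add, Prod.smul_fst, Prod.smul_snd, smul_eq_mul] at e₁ e₂
  constructor
  -- Pairing with `T` isolates the first coefficient; the next line pairs with `-*T`, the sign
  -- coming from `η(*T,*T) = -η(T,T)`.
  · exact mul_right_cancel₀ h (by linear_combination y * e₂ - x * e₁)
  · exact mul_right_cancel₀ h (by linear_combination y * e₁ - x * e₂)

theorem contDiffOn_eta {U : Set (ℝ × ℝ)} {v w : ℝ × ℝ → ℝ × ℝ} (hv : ContDiffOn ℝ ∞ v U)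
    (hw : ContDiffOn ℝ ∞ w U) : ContDiffOn ℝ ∞ (fun z => eta (v z) (w z)) U :=
  ((hv.fst.mul hw.fst).neg).add (hv.snd.mul hw.snd)

theorem contDiffOn_hodge {U : Set (ℝ × ℝ)} {v : ℝ × ℝ → ℝ × ℝ} (hv : ContDiffOn ℝ ∞ v U) :
    ContDiffOn ℝ ∞ (fun z => hodge (v z)) U :=
  hv.snd.prodMk hv.fst

theorem hasDerivAt_eta_self {v : ℝ → ℝ × ℝ} {v' : ℝ × ℝ} {s : ℝ} (h : HasDerivAt v v' s) :
    HasDerivAt (fun s => eta (v s) (v s)) (2 * eta v' (v s)) s := by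
  have h₁ : HasDerivAt (fun s => (v s).1) v'.1 s := by
    exact (hasFDerivAt_fst (𝕜 := ℝ) (p := v s)).comp_hasDerivAt s h
  have h₂ : HasDerivAt (fun s => (v s).2) v'.2 s := by
    exact (hasFDerivAt_snd (𝕜 := ℝ) (p := v s)).comp_hasDerivAt s h
  refine ((h₁.mul h₁).neg.add (h₂.mul h₂)).congr_deriv ?_
  simp only [eta]
  ring

theorem hasDerivAt_hodge {v : ℝ → ℝ × ℝ} {v' : ℝ × ℝ} {s : ℝ} (h : HasDerivAt v v' s) :
    HasDerivAt (fun s => hodge (v s)) (hodge v') s := by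
  have h₁ : HasDerivAt (fun s => (v s).1) v'.1 s := by
    exact (hasFDerivAt_fst (𝕜 := ℝ) (p := v s)).comp_hasDerivAt s h
  have h₂ : HasDerivAt (fun s => (v s).2) v'.2 s := by
    exact (hasFDerivAt_snd (𝕜 := ℝ) (p := v s)).comp_hasDerivAt s h
  exact h₂.prodMk h₁

/-! ### Structure equations of inelastic curve flows. -/

namespace IsInelasticFlow

variable {σ : ℝ} {U : Set (ℝ × ℝ)} {γ : ℝ × ℝ → ℝ × ℝ}

theorem eta_tangent (h : IsInelasticFlow σ U γ) {z : ℝ × ℝ} (hz : z ∈ U) :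
    eta (tangent γ z) (tangent γ z) = σ := h.arclength z hz

theorem eta_tangent_ne_zero (h : IsInelasticFlow σ U γ) {z : ℝ × ℝ} (hz : z ∈ U) :
    eta (tangent γ z) (tangent γ z) ≠ 0 := by
  rw [h.eta_tangent hz]
  rcases h.sign with h | h <;> simp [h]

theorem contDiffOn_tangent (h : IsInelasticFlow σ U γ) : ContDiffOn ℝ ∞ (tangent γ) U :=
  contDiffOn_dx h.isOpen h.smooth

theorem contDiffOn_normal (h : IsInelasticFlow σ U γ) : ContDiffOn ℝ ∞ (normal γ) U :=
  contDiffOn_hodge h.contDiffOn_tangent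

theorem contDiffOn_parComponent (h : IsInelasticFlow σ U γ) {v : ℝ × ℝ → ℝ × ℝ}
    (hv : ContDiffOn ℝ ∞ v U) : ContDiffOn ℝ ∞ (parComponent γ v) U :=
  (contDiffOn_eta hv h.contDiffOn_tangent).div
    (contDiffOn_eta h.contDiffOn_tangent h.contDiffOn_tangent) fun _ hz => h.eta_tangent_ne_zero hz

theorem contDiffOn_perpComponent (h : IsInelasticFlow σ U γ) {v : ℝ × ℝ → ℝ × ℝ}
    (hv : ContDiffOn ℝ ∞ v U) : ContDiffOn ℝ ∞ (perpComponent γ v) U :=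
  (contDiffOn_eta hv h.contDiffOn_normal).div
    (contDiffOn_eta h.contDiffOn_normal h.contDiffOn_normal) fun z hz => by
      rw [normal, eta_hodge_self]
      exact neg_ne_zero.2 (h.eta_tangent_ne_zero hz)

theorem eq_components (h : IsInelasticFlow σ U γ) (v : ℝ × ℝ → ℝ × ℝ) {z : ℝ × ℝ} (hz : z ∈ U) :
    v z = parComponent γ v z • tangent γ z + perpComponent γ v z • normal γ z :=
  eq_frame_components (h.eta_tangent_ne_zero hz)

theorem components_injective (h : IsInelasticFlow σ U γ) {z : ℝ × ℝ} (hz : z ∈ U) {a b c d : ℝ}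
    (e : a • tangent γ z + b • normal γ z = c • tangent γ z + d • normal γ z) : a = c ∧ b = d :=
  frame_components_injective (h.eta_tangent_ne_zero hz) e

/-- Since `η(T,T)` is constant, `T_x` is orthogonal to `T`; only the normal component remains, and
that component is `u` by definition. -/
theorem dx_tangent (h : IsInelasticFlow σ U γ) {z : ℝ × ℝ} (hz : z ∈ U) :
    dx (tangent γ) z = curvature γ z • normal γ z := by
  have h₁ := (hasDerivAt_eta_self (hasDerivAt_dx h.isOpen h.contDiffOn_tangent hz)).deriv
  have h₂ : dx (fun z => eta (tangent γ z) (tangent γ z)) z = 0 := by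
    rw [dx_congr h.isOpen (g := fun _ => σ) (fun z hz => h.eta_tangent hz) hz]
    simp [dx]
  have h₃ : eta (dx (tangent γ) z) (tangent γ z) = 0 := by
    have := h₁.symm.trans h₂
    simpa using this
  have h₄ := h.eq_components (dx (tangent γ)) hz
  rwa [parComponent, h₃, zero_div, zero_smul, zero_add] at h₄

theorem dt_tangent (h : IsInelasticFlow σ U γ) {z : ℝ × ℝ} (hz : z ∈ U) :
    dt (tangent γ) z = omega γ z • normal γ z := by
  have h₁ := (hasDerivAt_eta_self (hasDerivAt_dt h.isOpen h.contDiffOn_tangent hz)).deriv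
  have h₂ : dt (fun z => eta (tangent γ z) (tangent γ z)) z = 0 := by
    rw [dt_congr h.isOpen (g := fun _ => σ) (fun z hz => h.eta_tangent hz) hz]
    simp [dt]
  have h₃ : eta (dt (tangent γ) z) (tangent γ z) = 0 := by
    have := h₁.symm.trans h₂
    simpa using this
  have h₄ := h.eq_components (dt (tangent γ)) hz
  rwa [parComponent, h₃, zero_div, zero_smul, zero_add] at h₄

/-- The Hodge dual is linear with constant coefficients and is an involution, so `N_x = *(T_x) = u
**T = u T`. -/
theorem dx_normal (h : IsInelasticFlow σ U γ) {z : ℝ × ℝ} (hz : z ∈ U) :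
    dx (normal γ) z = curvature γ z • tangent γ z := by
  have h₁ := (hasDerivAt_hodge (hasDerivAt_dx h.isOpen h.contDiffOn_tangent hz)).deriv
  rw [h.dx_tangent hz] at h₁
  exact h₁

theorem dt_normal (h : IsInelasticFlow σ U γ) {z : ℝ × ℝ} (hz : z ∈ U) :
    dt (normal γ) z = omega γ z • tangent γ z := by
  have h₁ := (hasDerivAt_hodge (hasDerivAt_dt h.isOpen h.contDiffOn_tangent hz)).deriv
  rw [h.dt_tangent hz] at h₁
  exact h₁

theorem contDiffOn_curvature (h : IsInelasticFlow σ U γ) : ContDiffOn ℝ ∞ (curvature γ) U :=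
  h.contDiffOn_perpComponent (contDiffOn_dx h.isOpen h.contDiffOn_tangent)

theorem contDiffOn_omega (h : IsInelasticFlow σ U γ) : ContDiffOn ℝ ∞ (omega γ) U :=
  h.contDiffOn_perpComponent (contDiffOn_dt h.isOpen h.contDiffOn_tangent)

theorem contDiffOn_hPar (h : IsInelasticFlow σ U γ) : ContDiffOn ℝ ∞ (hPar γ) U :=
  h.contDiffOn_parComponent (contDiffOn_dt h.isOpen h.smooth)

theorem contDiffOn_hPerp (h : IsInelasticFlow σ U γ) : ContDiffOn ℝ ∞ (hPerp γ) U :=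
  h.contDiffOn_perpComponent (contDiffOn_dt h.isOpen h.smooth)

/-- The compatibility `T_{xt} = T_{tx}` of the frame equations. -/
theorem dt_curvature (h : IsInelasticFlow σ U γ) {z : ℝ × ℝ} (hz : z ∈ U) :
    dt (curvature γ) z = dx (omega γ) z := by
  have e := dt_dx_comm h.isOpen h.contDiffOn_tangent hz
  rw [dt_congr h.isOpen (g := curvature γ • normal γ) (fun z hz => h.dx_tangent hz) hz,
    dx_congr h.isOpen (g := omega γ • normal γ) (fun z hz => h.dt_tangent hz) hz,
    dt_smul h.isOpen h.contDiffOn_curvature h.contDiffOn_normal hz,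
    dx_smul h.isOpen h.contDiffOn_omega h.contDiffOn_normal hz, h.dt_normal hz, h.dx_normal hz,
    smul_smul, smul_smul] at e
  exact (h.components_injective hz e).2

/-- The compatibility `γ_{xt} = γ_{tx}` of the frame equations. -/
theorem dx_hPar_and_omega (h : IsInelasticFlow σ U γ) {z : ℝ × ℝ} (hz : z ∈ U) :
    dx (hPar γ) z = -(curvature γ z * hPerp γ z) ∧
      omega γ z = dx (hPerp γ) z + curvature γ z * hPar γ z := by
  have e := dt_dx_comm h.isOpen h.smooth hz
  have hp : ContDiffOn ℝ ∞ (hPar γ • tangent γ) U := h.contDiffOn_hPar.smul h.contDiffOn_tangent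
  have hn : ContDiffOn ℝ ∞ (hPerp γ • normal γ) U := h.contDiffOn_hPerp.smul h.contDiffOn_normal
  rw [dx_congr h.isOpen (f := dt γ) (g := hPar γ • tangent γ + hPerp γ • normal γ)
      (fun z hz => h.eq_components (dt γ) hz) hz, dx_add h.isOpen hp hn hz,
    dx_smul h.isOpen h.contDiffOn_hPar h.contDiffOn_tangent hz,
    dx_smul h.isOpen h.contDiffOn_hPerp h.contDiffOn_normal hz, h.dx_tangent hz,
    h.dx_normal hz] at e
  -- The left side is `T_t`, which has no tangential component; comparing components therefore gives
  -- one equation for `h_∥` and one for `ω`.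
  have e' : (0 : ℝ) • tangent γ z + omega γ z • normal γ z =
      (dx (hPar γ) z + curvature γ z * hPerp γ z) • tangent γ z +
        (dx (hPerp γ) z + curvature γ z * hPar γ z) • normal γ z := by
    rw [← h.dt_tangent hz, zero_smul, zero_add]
    refine e.trans ?_
    module
  obtain ⟨e₁, e₂⟩ := h.components_injective hz e'
  exact ⟨by linarith, e₂⟩

theorem opH_omega (h : IsInelasticFlow σ U γ) :
    opH (flowCalculus U) (omega γ) (dt (curvature γ)) :=
  ⟨h.contDiffOn_omega, contDiffOn_dt h.isOpen h.contDiffOn_curvature, fun _ hz => h.dt_curvature hz⟩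

theorem isPrimitive_neg_hPar (h : IsInelasticFlow σ U γ) :
    IsPrimitive (flowCalculus U) (-hPar γ) (curvature γ * hPerp γ) := by
  refine ⟨h.contDiffOn_hPar.neg, fun z hz => ?_⟩
  refine (hasDerivAt_dx h.isOpen h.contDiffOn_hPar hz).neg.deriv.trans ?_
  rw [(h.dx_hPar_and_omega hz).1, neg_neg]
  rfl

theorem JVia_hPerp (h : IsInelasticFlow σ U γ) :
    JVia (flowCalculus U) (curvature γ) (-hPar γ) (hPerp γ) (omega γ) := by
  refine ⟨h.contDiffOn_hPerp, h.contDiffOn_omega, h.isPrimitive_neg_hPar, fun z hz => ?_⟩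
  rw [(h.dx_hPar_and_omega hz).2]
  change _ = dx (hPerp γ) z - curvature γ z * -hPar γ z
  ring

theorem RVia_hPerp (h : IsInelasticFlow σ U γ) :
    RVia (flowCalculus U) (curvature γ) (-hPar γ) (hPerp γ) (dt (curvature γ)) := by
  refine ⟨h.contDiffOn_hPerp, contDiffOn_dt h.isOpen h.contDiffOn_curvature,
    h.isPrimitive_neg_hPar, fun z hz => ?_⟩
  have hx := contDiffOn_dx h.isOpen h.contDiffOn_hPerp
  have hm : ContDiffOn ℝ ∞ (curvature γ • hPar γ) U :=
    h.contDiffOn_curvature.smul h.contDiffOn_hPar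
  -- Differentiate `ω = (h_⊥)_x + u h_∥`; replacing `(h_∥)_x` by `-u h_⊥` produces the local term
  -- `-u² h_⊥`.
  rw [h.dt_curvature hz, dx_congr h.isOpen (g := dx (hPerp γ) + curvature γ • hPar γ)
      (fun z hz => (h.dx_hPar_and_omega hz).2) hz, dx_add h.isOpen hx hm hz,
    dx_smul h.isOpen h.contDiffOn_curvature h.contDiffOn_hPar hz, (h.dx_hPar_and_omega hz).1]
  change _ = dx (dx (hPerp γ)) z - curvature γ z ^ 2 * hPerp γ z - dx (curvature γ) z * -hPar γ z
  simp only [smul_eq_mul]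
  ring

end IsInelasticFlow

end

end MinkowskiFlow

open MinkowskiFlow in
theorem mainTheorem4 :
    -- the structure equations of timelike and spacelike inelastic curve flows
    (∀ (σ : ℝ) (U : Set (ℝ × ℝ)) (γ : ℝ × ℝ → ℝ × ℝ), IsInelasticFlow σ U γ →
      -- `u`, `ω`, `h_∥`, `h_⊥` are the coefficients of the frame equations and the flow vector
      (∀ z ∈ U, dx (tangent γ) z = curvature γ z • normal γ z ∧
        dx (normal γ) z = curvature γ z • tangent γ z ∧
        dt (tangent γ) z = omega γ z • normal γ z ∧
        dt (normal γ) z = omega γ z • tangent γ z ∧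
        dt γ z = hPar γ z • tangent γ z + hPerp γ z • normal γ z) ∧
      -- `u_t = H(ω)`, `ω = J(h_⊥)`, `u_t = R(h_⊥)`, where `D_x⁻¹(u h_⊥) = -h_∥`
      opH (flowCalculus U) (omega γ) (dt (curvature γ)) ∧
      JVia (flowCalculus U) (curvature γ) (-hPar γ) (hPerp γ) (omega γ) ∧
      RVia (flowCalculus U) (curvature γ) (-hPar γ) (hPerp γ) (dt (curvature γ))) ∧
    -- `H` and `J` are a compatible pair of a Hamiltonian and a symplectic operator
    IsHamiltonian (opH jetCalculus) ∧
    IsSymplectic (opJ jetCalculus (jetU 0)) ∧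
    IsCompatiblePair (opH jetCalculus) (opJ jetCalculus (jetU 0)) ∧
    -- `R = H J`
    Op.comp (opH jetCalculus) (opJ jetCalculus (jetU 0)) = opR jetCalculus (jetU 0) ∧
    -- `R` is a hereditary recursion operator, for the root flow `u_t = u_x` and for `u_t = R(u_x)`
    IsHereditary (opR jetCalculus (jetU 0)) ∧
    IsRecursionOperatorOf (opR jetCalculus (jetU 0)) (jetU 1) ∧
    opR jetCalculus (jetU 0) (jetU 1) (jetU 3 - (3 / 2 : ℝ) • (jetU 0 ^ 2 * jetU 1)) ∧
    IsRecursionOperatorOf (opR jetCalculus (jetU 0))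
      (jetU 3 - (3 / 2 : ℝ) • (jetU 0 ^ 2 * jetU 1)) := by
  exact ⟨fun _ _ _ h => ⟨fun _ hz => ⟨h.dx_tangent hz, h.dx_normal hz, h.dt_tangent hz,
      h.dt_normal hz, h.eq_components _ hz⟩, h.opH_omega, h.JVia_hPerp, h.RVia_hPerp⟩,
    isHamiltonian_opH, isSymplectic_opJ, isCompatiblePair_opH_opJ, opH_comp_opJ, isHereditary_opR,
    isRecursionOperatorOf_opR_jetU_one, opR_jetU_one, isRecursionOperatorOf_opR_mkdv⟩
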